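/- Let $N,r\ge 0$, and let $\ddot y^{\mu}=\omega^{\mu}(x,y,\dot y)$, $\mu=1,\dots,N$, be a system of ordinary differential equations with $\omega$ smooth on an open set $J$ of the space of jets $(x,y,\dot y)$, whose projection $U$ to the space of $(x,y)$ is connected. Put $\mathbf A=\partial_x+\dot y^{\kappa}\partial_{y^\kappa}+\omega^{\kappa}\partial_{\dot y^\kappa}$. For a vector field $\mathbf Z=\xi\,\partial_x+\eta^\mu\partial_{y^\mu}$ on $U$ let $\mathbf Z^{(1)}=\xi\,\partial_x+\eta^\mu\partial_{y^\mu}+\bigl(\frac{d\eta^\mu}{dx}-\dot y^\mu\frac{d\xi}{dx}\bigr)\partial_{\dot y^\mu}$ be its first prolongation, where $\frac{d}{dx}=\partial_x+\dot y^\kappa\partial_{y^\kappa}$. Call $\mathbf Z$ a Lie point symmetry if $[\mathbf Z^{(1)},\mathbf A]=-\mathbf A(\xi)\,\mathbf A$ on $J$. Let $\mathbf Z_1,\dots,\mathbf Z_r$ be smooth Lie point symmetries on $U$, linearly independent over $\mathbb R$, that form a Lie algebra, $[\mathbf Z_M,\mathbf Z_K]=\sum_L C^L_{MK}\mathbf Z_L$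 with constants $C^L_{MK}$. Let $\{\mathbf Z_i\}_{i\in I}$, $|I|=m$, be some of them that commute with each other and are linearly independent at every point of $U$ (they span an Abelian subalgebra acting transitively in a subspace of dimension $m$). If $m=N$, assume moreover that $\mathbf A$ is linearly independent of the generators in the following sense: the jets in $J$ at which $\mathbf A$ is not in the linear span of $\mathbf Z^{(1)}_1,\dots,\mathbf Z^{(1)}_r$ are dense in $J$. A vector field $\mathbf X$ on $U$ is called inherited if around each point of $U$ there are smooth coordinates $(t,s^1,\dots,s^N)$ ($t$ the new independent variable, $s^\mu$ the new dependent ones) such that, after a numbering of $I$ by $1,\dots,m$, $\mathbf Z_i=\partial_{s^i}$ for $i=1,\dots,m$, and such that the following holds at all corresponding jets $(t,s,\dot s)$. Let $\ddot s^\mu=\tilde\omega^\mu(t,s,\dot s)$ be the transformed system, $\mathbf X=\xi\,\partial_t+\eta^\mu\partial_{s^\mu}$ with first prolongation $\mathbf X^{(1)}=\xi\,\partial_t+\eta^\mu\partial_{s^\mu}+\eta^{(1)\mu}\partial_{\dot s^\mu}$, and let $$\hat{\mathbf A}=\partial_t+\sum_{\beta>m}\dot s^\beta\partial_{s^\beta}+\sum_{\mu}\tilde\omega^\mu\partial_{\dot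 s^\mu},\qquad \mathbf Y=\xi\,\partial_t+\sum_{\beta>m}\eta^\beta\partial_{s^\beta}+\sum_{\mu}\eta^{(1)\mu}\partial_{\dot s^\mu}$$ be the reductions of $\mathbf A$ and $\mathbf X^{(1)}$ to the hypersurfaces $s^1,\dots,s^m=\text{const}$ (with coordinates $t$, $s^\beta$, $u^i=\dot s^i$, $\dot s^\beta$). Then $[\mathbf Y,\hat{\mathbf A}]=-\hat{\mathbf A}(\xi)\,\hat{\mathbf A}$. Let $\{\mathbf Z_{\bar l}\}_{\bar l\in H}$, $H\cap I=\emptyset$, be inherited generators, and suppose that the remaining generators $\mathbf Z_\tau$ ($\tau\notin I\cup H$) do not contribute to what is inherited: every inherited linear combination $\sum_M c_M\mathbf Z_M$ with real coefficients has $c_\tau=0$ for all $\tau\notin I\cup H$. Then $\{\mathbf Z_l,\mathbf Z_{\bar l}\}$ forms a subalgebra of the original algebra, that is, the real linear span of these fields is closed under the commutator on $U$. Explicitly, for $i,j\in I$ and $\bar l,\bar k\in H$, $$[\mathbf Z_i,\mathbf Z_j]=0,\qquad [\mathbf Z_i,\mathbf Z_{\bar l}]=\sum_{l\in I}C^{l}_{i\bar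 l}\,\mathbf Z_l,\qquad [\mathbf Z_{\bar l},\mathbf Z_{\bar k}]=\sum_{l\in I}C^{l}_{\bar l\bar k}\,\mathbf Z_l+\sum_{\bar q\in H}C^{\bar q}_{\bar l\bar k}\,\mathbf Z_{\bar q}.$$ -/

import Mathlib

open scoped ContDiff

/-- The space of the independent variable `x` and the dependent variables `y^1, …, y^N`. -/
abbrev Base (N : ℕ) : Type := ℝ × (Fin N → ℝ)

/-- The first-order jet space, with coordinates `(x, y, y')`. -/
abbrev Jet (N : ℕ) : Type := ℝ × (Fin N → ℝ) × (Fin N → ℝ)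

/-- The projection `(x, y, y') ↦ (x, y)`. -/
def base {N : ℕ} (q : Jet N) : Base N := (q.1, q.2.1)

/-- The total derivative `df/dx = ∂f/∂x + y'^κ ∂f/∂y^κ` of a map `f` of `(x, y)`, at a jet. -/
noncomputable def totalDeriv {N : ℕ} {F : Type*} [NormedAddCommGroup F] [NormedSpace ℝ F]
    (f : Base N → F) (q : Jet N) : F :=
  fderiv ℝ f (base q) (1, q.2.2)

/-- The operator `A = ∂_x + y'^κ ∂_{y^κ} + w^κ(x, y, y') ∂_{y'^κ}` of the system `y'' = w(x, y, y')`,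
as a vector field on the jet space. -/
def odeField {N : ℕ} (w : Jet N → (Fin N → ℝ)) (q : Jet N) : Jet N :=
  (1, q.2.2, w q)

/-- The first prolongation of a vector field `Z = ξ ∂_x + η^μ ∂_{y^μ}`:
`Z⁽¹⁾ = ξ ∂_x + η^μ ∂_{y^μ} + (dη^μ/dx - y'^μ dξ/dx) ∂_{y'^μ}`. -/
noncomputable def prolong {N : ℕ} (Z : Base N → Base N) (q : Jet N) : Jet N :=
  ((Z (base q)).1, (Z (base q)).2, (totalDeriv Z q).2 - (totalDeriv Z q).1 • q.2.2)

/-- The symmetry condition `[V, A] = -A(ξ) A` on a set `J` of jets, where `ξ` is the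
`∂_x`-component of the vector field `V`. -/
def SymmetryCondition {N : ℕ} (J : Set (Jet N)) (V A : Jet N → Jet N) : Prop :=
  ∀ q ∈ J, VectorField.lieBracket ℝ V A q = -(fderiv ℝ (fun q' => (V q').1) q (A q)) • A q

/-- `Z` generates a Lie point symmetry of the system `y'' = w(x, y, y')` on `J`. -/
def IsPointSymmetry {N : ℕ} (J : Set (Jet N)) (w : Jet N → (Fin N → ℝ))
    (Z : Base N → Base N) : Prop :=
  SymmetryCondition J (prolong Z) (odeField w)

/-! ### Point transformations `(x, y) ↦ (t(x, y), s(x, y))` -/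

/-- The action of a point transformation `φ = (t, s)` on jets,
`(x, y, y') ↦ (t, s, (ds/dx) / (dt/dx))`; it is meaningful where `dt/dx ≠ 0`. -/
noncomputable def jetMap {N : ℕ} (φ : Base N → Base N) (q : Jet N) : Jet N :=
  ((φ (base q)).1, (φ (base q)).2, (totalDeriv φ q).1⁻¹ • (totalDeriv φ q).2)

/-- The jets in the new coordinates `(t, s, s')` that correspond to jets in `J`. -/
def transformedDomain {N : ℕ} (φ : OpenPartialHomeomorph (Base N) (Base N)) (J : Set (Jet N)) :
    Set (Jet N) :=
  {q | base q ∈ φ.target ∧ (totalDeriv φ.symm q).1 ≠ 0 ∧ jetMap φ.symm q ∈ J}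

/-- The right-hand side `w̃` of the system `s'' = w̃(t, s, s')` into which `y'' = w(x, y, y')` is
transformed: `w̃ = A(s') / A(t)`, evaluated at the old jet and written in the new coordinates. -/
noncomputable def transformedRHS {N : ℕ} (φ : OpenPartialHomeomorph (Base N) (Base N))
    (w : Jet N → (Fin N → ℝ)) (q : Jet N) : Fin N → ℝ :=
  (totalDeriv φ (jetMap φ.symm q)).1⁻¹ •
    fderiv ℝ (fun q' => (jetMap φ q').2.2) (jetMap φ.symm q) (odeField w (jetMap φ.symm q))

/-- The vector field `Z` written in the new coordinates. -/
noncomputable def transformedField {N : ℕ} (φ : OpenPartialHomeomorph (Base N) (Base N))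
    (Z : Base N → Base N) (p : Base N) : Base N :=
  fderiv ℝ φ (φ.symm p) (Z (φ.symm p))

/-- `φ = (t, s)` is a smooth change of coordinates on an open part of `U` that brings the
fields `Z_i`, `i ∈ I`, into their normal form `Z_i = ∂_{s^{e i}}`. -/
structure IsNormalForm {N r : ℕ} (U : Set (Base N)) (Z : Fin r → Base N → Base N)
    (I : Finset (Fin r)) (φ : OpenPartialHomeomorph (Base N) (Base N)) (e : I ↪ Fin N) : Prop where
  source_subset : φ.source ⊆ U
  contDiffOn : ContDiffOn ℝ ∞ φ φ.source
  contDiffOn_symm : ContDiffOn ℝ ∞ φ.symm φ.target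
  normal : ∀ i : I, ∀ p ∈ φ.target, transformedField φ (Z i) p = (0, Pi.single (e i) 1)

/-! ### Reduction and inheritance -/

/-- The reduction of a vector field on the jet space to the hypersurfaces
`s^μ = constant`, `μ ∈ S`, with coordinates `t`, `s^β` (`β ∉ S`), `u^μ = s'^μ` (`μ ∈ S`) and `s'^β`:
the `∂_{s^μ}`-components, `μ ∈ S`, are dropped and all other components are kept. -/
noncomputable def reduce {N : ℕ} (S : Set (Fin N)) (V : Jet N → Jet N) (q : Jet N) : Jet N :=
  open scoped Classical in
  ((V q).1, (fun μ => if μ ∈ S then 0 else (V q).2.1 μ), (V q).2.2)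

/-- The field `X` is inherited by the reduction along the fields `Z_i`, `i ∈ I`: around each
point of the `(x, y)`-domain there are coordinates in which the `Z_i` have their normal form
and in which the reduced prolongation `Y` of `X` and the reduced operator `Â` of the system
satisfy the symmetry condition `[Y, Â] = -Â(ξ) Â` of the reduced system, where `ξ` is the
`∂_t`-component of `X`. -/
def IsInherited {N r : ℕ} (J : Set (Jet N)) (w : Jet N → (Fin N → ℝ))
    (Z : Fin r → Base N → Base N) (I : Finset (Fin r)) (X : Base N → Base N) : Prop :=
  ∀ p ∈ base '' J, ∃ (φ : OpenPartialHomeomorph (Base N) (Base N)) (e : I ↪ Fin N),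
    p ∈ φ.source ∧ IsNormalForm (base '' J) Z I φ e ∧
      SymmetryCondition (transformedDomain φ J)
        (reduce (Set.range e) (prolong (transformedField φ X)))
        (reduce (Set.range e) (odeField (transformedRHS φ w)))

open scoped Topology

/-! The core is a characterisation: a generator `X` can be inherited only if every `[Z_i, X]`, `i ∈
I`, is a combination of the `Z_j`, `j ∈ I`, with constant coefficients; conversely, this suffices
for a symmetry when normal forms exist.

In normal form, `Z_i = ∂_{s^i}`, the system does not depend on the `s^i`, and `[Z_i, X] = ∂_{s^i}
X`. Let `b = Σ s'^i ∂_{s^i}` be the part of `A` lost in the reduction. The reduced symmetry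
condition then says that the prolongation of `∂_b X` (coefficients of `b` frozen) minus `(∂_b ξ) A`
reduces to zero (`symmetryCondition_reduce_iff`). Its components are `∂_b η^β - s'^β ∂_b ξ`, `β ∉
range e`, and, once these vanish identically, the total derivatives of `∂_b X`. All are polynomials
of degree at most two in the velocities, so vanishing on an open set of jets makes them vanish
identically, and `∂_{s^i} X` is locally a constant combination of the `∂_{s^j}`
(`isVerticallyAffine_of_reduceL`). If no `β` is left, `∂_b ξ ≠ 0` would put `A` into the span of the
prolonged generators on an open set of jets, which the density hypothesis excludes
(`fst_eq_zero_of_dense`).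

Pointwise independence of the `Z_i` and connectedness make the local constants global, and
independence over ℝ identifies them with structure constants. This settles `[Z_i, Z_l]` for `l ∈ H`.
For `l, k ∈ H` the Jacobi identity shows that `[Z_l, Z_k]` meets the same criterion, hence is
inherited, and the assumption on the remaining generators removes all other coefficients. -/

lemma minSmoothness_two_le_infty : minSmoothness ℝ 2 ≤ ∞ := by
  rw [minSmoothness_of_isRCLikeNormedField]
  exact WithTop.coe_le_coe.2 le_top

/-! ### Calculus on the jet space -/

/-- The projection from jets to the base, as a continuous linear map. -/
def baseL (N : ℕ) : Jet N →L[ℝ] Base N :=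
  (ContinuousLinearMap.fst ℝ ℝ _).prod
    ((ContinuousLinearMap.fst ℝ _ _).comp (ContinuousLinearMap.snd ℝ ℝ _))

lemma baseL_apply {N : ℕ} (q : Jet N) : baseL N q = base q := rfl

/-- The projection of jets to the derivatives of the dependent variables. -/
def velL (N : ℕ) : Jet N →L[ℝ] (Fin N → ℝ) :=
  (ContinuousLinearMap.snd ℝ _ _).comp (ContinuousLinearMap.snd ℝ ℝ _)

lemma velL_apply {N : ℕ} (q : Jet N) : velL N q = q.2.2 := rfl

lemma contDiff_base {N : ℕ} {n : ℕ∞ω} : ContDiff ℝ n (base : Jet N → Base N) :=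
  (baseL N).contDiff

lemma continuous_base {N : ℕ} : Continuous (base : Jet N → Base N) := (baseL N).continuous

lemma isOpenMap_base {N : ℕ} : IsOpenMap (base : Jet N → Base N) :=
  (baseL N).isOpenMap fun p => ⟨(p.1, p.2, 0), rfl⟩

lemma hasFDerivAt_base {N : ℕ} (q : Jet N) : HasFDerivAt base (baseL N) q :=
  (baseL N).hasFDerivAt

lemma contDiff_vel {N : ℕ} {n : ℕ∞ω} : ContDiff ℝ n (fun q : Jet N => q.2.2) :=
  (velL N).contDiff

lemma contDiffAt_totalDeriv {N : ℕ} {F : Type*} [NormedAddCommGroup F] [NormedSpace ℝ F]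
    {f : Base N → F} {q : Jet N} (hf : ContDiffAt ℝ ∞ f (base q)) :
    ContDiffAt ℝ ∞ (totalDeriv f) q := by
  have h1 : ContDiffAt ℝ ∞ (fderiv ℝ f) (base q) := hf.fderiv_right (by simp)
  have h2 : ContDiffAt ℝ ∞ (fun q : Jet N => fderiv ℝ f (base q)) q :=
    h1.comp q contDiff_base.contDiffAt
  exact h2.clm_apply (contDiffAt_const.prodMk contDiff_vel.contDiffAt)

lemma fderiv_totalDeriv {N : ℕ} {F : Type*} [NormedAddCommGroup F] [NormedSpace ℝ F]
    {f : Base N → F} {q : Jet N} (hf : ContDiffAt ℝ ∞ f (base q)) (h : Jet N) :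
    fderiv ℝ (totalDeriv f) q h =
      fderiv ℝ (fderiv ℝ f) (base q) (base h) (1, q.2.2) + fderiv ℝ f (base q) (0, h.2.2) := by
  have h1 : DifferentiableAt ℝ (fderiv ℝ f) (base q) :=
    (hf.fderiv_right (m := ∞) (by simp)).differentiableAt (by simp)
  have h2 := h1.hasFDerivAt.comp q (hasFDerivAt_base q)
  have h3 : HasFDerivAt (fun q : Jet N => ((1 : ℝ), q.2.2))
      ((0 : Jet N →L[ℝ] ℝ).prod (velL N)) q :=
    (hasFDerivAt_const (1 : ℝ) q).prodMk (velL N).hasFDerivAt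
  have h4 := h2.clm_apply h3
  have h5 : fderiv ℝ (totalDeriv f) q = _ := h4.fderiv
  rw [h5]
  simp [baseL_apply, velL_apply, add_comm]

lemma contDiffAt_prolong {N : ℕ} {X : Base N → Base N} {q : Jet N}
    (hX : ContDiffAt ℝ ∞ X (base q)) : ContDiffAt ℝ ∞ (prolong X) q := by
  have h0 : ContDiffAt ℝ ∞ (fun q : Jet N => X (base q)) q :=
    hX.comp q contDiff_base.contDiffAt
  have h1 := contDiffAt_totalDeriv hX
  exact h0.fst.prodMk (h0.snd.prodMk (h1.snd.sub (h1.fst.smul contDiff_vel.contDiffAt)))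

lemma contDiffAt_jetMap {N : ℕ} {φ : Base N → Base N} {q : Jet N}
    (hφ : ContDiffAt ℝ ∞ φ (base q)) (hl : (totalDeriv φ q).1 ≠ 0) :
    ContDiffAt ℝ ∞ (jetMap φ) q := by
  have h0 : ContDiffAt ℝ ∞ (fun q : Jet N => φ (base q)) q :=
    hφ.comp q contDiff_base.contDiffAt
  have h1 := contDiffAt_totalDeriv hφ
  exact h0.fst.prodMk (h0.snd.prodMk ((h1.fst.inv hl).smul h1.snd))

lemma fderiv_jetMap {N : ℕ} {φ : Base N → Base N} {q : Jet N}
    (hφ : ContDiffAt ℝ ∞ φ (base q)) (hl : (totalDeriv φ q).1 ≠ 0) (h : Jet N) :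
    fderiv ℝ (jetMap φ) q h =
      ((fderiv ℝ φ (base q) (base h)).1, (fderiv ℝ φ (base q) (base h)).2,
        (totalDeriv φ q).1⁻¹ • (fderiv ℝ (totalDeriv φ) q h).2 -
          (((totalDeriv φ q).1 ^ 2)⁻¹ * (fderiv ℝ (totalDeriv φ) q h).1) •
            (totalDeriv φ q).2) := by
  have h0 := (hφ.differentiableAt (by simp)).hasFDerivAt.comp q (hasFDerivAt_base q)
  have h1 := ((contDiffAt_totalDeriv hφ).differentiableAt (by simp)).hasFDerivAt
  have h2 := ((hasDerivAt_inv hl).comp_hasFDerivAt q h1.fst).smul h1.snd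
  have h3 := h0.fst.prodMk (h0.snd.prodMk h2)
  have h4 : fderiv ℝ (jetMap φ) q = _ := h3.fderiv
  rw [h4]
  ext <;> simp [baseL_apply]
  ring

/-- The derivative of `φ` carries the direction `(1, y')` of a curve to the direction `(1, s')` of
its image, up to the factor `dt/dx`. -/
lemma totalDeriv_eq_smul {N : ℕ} {φ : Base N → Base N} {q : Jet N}
    (hl : (totalDeriv φ q).1 ≠ 0) :
    totalDeriv φ q = (totalDeriv φ q).1 • ((1 : ℝ), (jetMap φ q).2.2) := by
  ext <;> simp [jetMap, hl]

/-! ### Prolongations, operators and brackets under maps -/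

/-- Prolongation commutes with point transformations. -/
lemma fderiv_jetMap_prolong {N : ℕ} {φ X X' : Base N → Base N} {q : Jet N}
    (hφ : ContDiffAt ℝ ∞ φ (base q)) (hl : (totalDeriv φ q).1 ≠ 0)
    (hX : ContDiffAt ℝ ∞ X (base q)) (hX' : ContDiffAt ℝ ∞ X' (φ (base q)))
    (h : ∀ᶠ p in 𝓝 (base q), X' (φ p) = fderiv ℝ φ p (X p)) :
    fderiv ℝ (jetMap φ) q (prolong X q) = prolong X' (jetMap φ q) := by
  have hdφ : DifferentiableAt ℝ φ (base q) := hφ.differentiableAt (by simp)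
  have hdX : DifferentiableAt ℝ X (base q) := hX.differentiableAt (by simp)
  have hdX' : DifferentiableAt ℝ X' (φ (base q)) := hX'.differentiableAt (by simp)
  have hddφ : DifferentiableAt ℝ (fderiv ℝ φ) (base q) :=
    (hφ.fderiv_right (m := ∞) (by simp)).differentiableAt (by simp)
  have hsymm : IsSymmSndFDerivAt ℝ φ (base q) :=
    hφ.isSymmSndFDerivAt minSmoothness_two_le_infty
  have hq : X' (φ (base q)) = fderiv ℝ φ (base q) (X (base q)) := h.self_of_nhds
  have hchain : ∀ v, fderiv ℝ X' (φ (base q)) (fderiv ℝ φ (base q) v) =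
      fderiv ℝ (fderiv ℝ φ) (base q) v (X (base q)) +
        fderiv ℝ φ (base q) (fderiv ℝ X (base q) v) := by
    intro v
    have e1 : fderiv ℝ (fun p => X' (φ p)) (base q) =
        (fderiv ℝ X' (φ (base q))).comp (fderiv ℝ φ (base q)) :=
      (hdX'.hasFDerivAt.comp (base q) hdφ.hasFDerivAt).fderiv
    have e2 := (hddφ.hasFDerivAt.clm_apply hdX.hasFDerivAt).fderiv
    have e3 : fderiv ℝ (fun p => X' (φ p)) (base q) = _ := Filter.EventuallyEq.fderiv_eq h
    rw [e1, e2] at e3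
    have := DFunLike.congr_fun e3 v
    simpa [add_comm] using this
  set v : Base N := (1, q.2.2) with hv
  set l := (totalDeriv φ q).1 with hldef
  set a := (totalDeriv X q).1 with ha
  set s := (jetMap φ q).2.2 with hs
  have hP : fderiv ℝ φ (base q) v = l • ((1 : ℝ), s) := totalDeriv_eq_smul hl
  have hB : base (prolong X q) = X (base q) := rfl
  -- Read as a vertical base vector, the velocity part of the prolongation is `DX(v) - a v`. With
  -- the symmetry of the second derivative of `φ`, the term `DX(v)` completes the right side of
  -- `hchain`.
  have hdec : ((0 : ℝ), (prolong X q).2.2) = fderiv ℝ X (base q) v - a • v := by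
    ext <;> simp [prolong, hv, ha, totalDeriv]
  have hδ : fderiv ℝ (totalDeriv φ) q (prolong X q) =
      l • fderiv ℝ X' (φ (base q)) ((1 : ℝ), s) - (a * l) • ((1 : ℝ), s) := by
    rw [fderiv_totalDeriv hφ, hdec, hB, map_sub, map_smul, ← hv, hsymm.eq, ← add_sub_assoc,
      ← hchain, hP, map_smul, mul_smul]
  have hT : totalDeriv X' (jetMap φ q) = fderiv ℝ X' (φ (base q)) ((1 : ℝ), s) := rfl
  have hP2 : totalDeriv φ q = l • ((1 : ℝ), s) := hP
  rw [fderiv_jetMap hφ hl, hδ, hB, ← hq]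
  ext1
  · rfl
  ext1
  · rfl
  · simp only [prolong, hT, ← hldef, ← hs]
    rw [hP2]
    ext i
    simp
    field_simp
    ring

/-- The operator of a system, under a point transformation. -/
lemma fderiv_jetMap_odeField {N : ℕ} {φ : Base N → Base N} {w w' : Jet N → (Fin N → ℝ)}
    {q : Jet N} (hφ : ContDiffAt ℝ ∞ φ (base q)) (hl : (totalDeriv φ q).1 ≠ 0)
    (hw' : w' (jetMap φ q) = (totalDeriv φ q).1⁻¹ •
      fderiv ℝ (fun q' => (jetMap φ q').2.2) q (odeField w q)) :
    fderiv ℝ (jetMap φ) q (odeField w q) =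
      (totalDeriv φ q).1 • odeField w' (jetMap φ q) := by
  have h1 := ((contDiffAt_jetMap hφ hl).differentiableAt (by simp)).hasFDerivAt
  have h2 : fderiv ℝ (fun q' => (jetMap φ q').2.2) q (odeField w q) =
      (fderiv ℝ (jetMap φ) q (odeField w q)).2.2 := by
    rw [(h1.snd.snd).fderiv]; rfl
  have hP := totalDeriv_eq_smul hl
  have hb : base (odeField w q) = (1, q.2.2) := rfl
  have h3 : fderiv ℝ φ (base q) (base (odeField w q)) =
      (totalDeriv φ q).1 • ((1 : ℝ), (jetMap φ q).2.2) := hP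
  ext1
  · rw [fderiv_jetMap hφ hl, h3]; simp [odeField]
  ext1
  · rw [fderiv_jetMap hφ hl, h3]; simp [odeField]
  · simp only [odeField, Prod.smul_snd, hw']
    simp only [odeField] at h2
    rw [h2, smul_inv_smul₀ hl]

/-- Second derivatives of `F` cancel by symmetry, so relatedness near `x` is enough; `F` need not be
invertible. -/
lemma fderiv_lieBracket_of_related {E : Type*} [NormedAddCommGroup E] [NormedSpace ℝ E]
    {F V W V' W' : E → E} {x : E} (hF : ContDiffAt ℝ ∞ F x)
    (hV : DifferentiableAt ℝ V x) (hW : DifferentiableAt ℝ W x)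
    (hV' : DifferentiableAt ℝ V' (F x)) (hW' : DifferentiableAt ℝ W' (F x))
    (hVV : ∀ᶠ y in 𝓝 x, V' (F y) = fderiv ℝ F y (V y))
    (hWW : ∀ᶠ y in 𝓝 x, W' (F y) = fderiv ℝ F y (W y)) :
    VectorField.lieBracket ℝ V' W' (F x) =
      fderiv ℝ F x (VectorField.lieBracket ℝ V W x) := by
  have hd : DifferentiableAt ℝ F x := hF.differentiableAt (by simp)
  rw [VectorField.fderiv_apply_lieBracket hF minSmoothness_two_le_infty hW hV]
  have e1 : fderiv ℝ (fun y => V' (F y)) x = _ := Filter.EventuallyEq.fderiv_eq hVV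
  have e2 : fderiv ℝ (fun y => W' (F y)) x = _ := Filter.EventuallyEq.fderiv_eq hWW
  have e3 : fderiv ℝ (fun y => V' (F y)) x = (fderiv ℝ V' (F x)).comp (fderiv ℝ F x) :=
    (hV'.hasFDerivAt.comp x hd.hasFDerivAt).fderiv
  have e4 : fderiv ℝ (fun y => W' (F y)) x = (fderiv ℝ W' (F x)).comp (fderiv ℝ F x) :=
    (hW'.hasFDerivAt.comp x hd.hasFDerivAt).fderiv
  rw [← e1, ← e2, e3, e4]
  simp [VectorField.lieBracket, hVV.self_of_nhds, hWW.self_of_nhds]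

/-- A quadratic function that vanishes on a nonempty open set vanishes. -/
lemma eq_zero_of_quadratic_of_isOpen {E : Type*} [NormedAddCommGroup E] [NormedSpace ℝ E]
    {f : E → ℝ} (hf : ∀ v u, ∃ a b c : ℝ, ∀ t : ℝ, f (v + t • u) = a + b * t + c * t ^ 2)
    {O : Set E} (hO : IsOpen O) {v : E} (hv : v ∈ O) (h0 : ∀ u ∈ O, f u = 0) (u : E) :
    f u = 0 := by
  -- On the line through `v` and `u`, `f` is a polynomial of degree at most two that vanishes for
  -- small `t`. The values at `0` and `±ε/2` kill its coefficients, and `t = 1` is the point `u`.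
  obtain ⟨a, b, c, h⟩ := hf v (u - v)
  have hc : Continuous fun t : ℝ => v + t • (u - v) := by fun_prop
  have hn : ∀ᶠ t : ℝ in 𝓝 0, v + t • (u - v) ∈ O :=
    hc.continuousAt.preimage_mem_nhds (hO.mem_nhds (by simpa using hv))
  obtain ⟨ε, hε, hb⟩ := Metric.eventually_nhds_iff.1 hn
  have key : ∀ t : ℝ, |t| < ε → a + b * t + c * t ^ 2 = 0 := by
    intro t ht
    rw [← h t]
    exact h0 _ (hb (by simpa using ht))
  have k0 := key 0 (by simpa using hε)
  have k1 := key (ε / 2) (by rw [abs_of_pos (by positivity)]; linarith)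
  have k2 := key (-(ε / 2)) (by rw [abs_neg, abs_of_pos (by positivity)]; linarith)
  have ha : a = 0 := by linarith
  have hbz : b = 0 := by
    have : b * ε = 0 := by linarith
    exact (mul_eq_zero.1 this).resolve_right hε.ne'
  have hcz : c = 0 := by
    have : c * (ε / 2) ^ 2 = 0 := by subst ha hbz; linarith
    exact (mul_eq_zero.1 this).resolve_right (by positivity)
  have := h 1
  simp [ha, hbz, hcz] at this
  exact this

/-! ### Point transformations acting on jets and symmetries -/

/-- A local diffeomorphism of the base. -/
structure IsDiffeo {N : ℕ} (φ : OpenPartialHomeomorph (Base N) (Base N)) : Prop where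
  contDiffOn : ContDiffOn ℝ ∞ φ φ.source
  contDiffOn_symm : ContDiffOn ℝ ∞ φ.symm φ.target

namespace IsDiffeo

variable {N : ℕ} {φ : OpenPartialHomeomorph (Base N) (Base N)}

lemma symm (h : IsDiffeo φ) : IsDiffeo φ.symm :=
  ⟨h.contDiffOn_symm, by simpa using h.contDiffOn⟩

lemma contDiffAt (h : IsDiffeo φ) {p : Base N} (hp : p ∈ φ.source) : ContDiffAt ℝ ∞ φ p :=
  h.contDiffOn.contDiffAt (φ.open_source.mem_nhds hp)

lemma contDiffAt_symm (h : IsDiffeo φ) {p : Base N} (hp : p ∈ φ.target) :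
    ContDiffAt ℝ ∞ φ.symm p :=
  h.symm.contDiffAt hp

lemma fderiv_symm_fderiv (h : IsDiffeo φ) {p : Base N} (hp : p ∈ φ.source) (v : Base N) :
    fderiv ℝ φ.symm (φ p) (fderiv ℝ φ p v) = v := by
  have h1 := ((h.contDiffAt_symm (φ.map_source hp)).differentiableAt (by simp)).hasFDerivAt.comp p
    ((h.contDiffAt hp).differentiableAt (by simp)).hasFDerivAt
  have h2 : (φ.symm ∘ φ) =ᶠ[𝓝 p] id := by
    filter_upwards [φ.open_source.mem_nhds hp] with y hy
    exact φ.left_inv hy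
  have h3 := h1.fderiv.symm.trans (h2.fderiv_eq.trans fderiv_id)
  exact DFunLike.congr_fun h3 v

lemma fderiv_fderiv_symm (h : IsDiffeo φ) {p : Base N} (hp : p ∈ φ.target) (v : Base N) :
    fderiv ℝ φ (φ.symm p) (fderiv ℝ φ.symm p v) = v := by
  have := h.symm.fderiv_symm_fderiv (p := p) hp v
  simpa using this

/-- The inverse derivative sends `(1, s')` back to a multiple of `(1, y')`, with the reciprocal
factor. The first conjunct also shows that the inverse jet map is meaningful at the image. -/
lemma jetMap_left_inv (h : IsDiffeo φ) {q : Jet N} (hq : base q ∈ φ.source)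
    (hl : (totalDeriv φ q).1 ≠ 0) :
    (totalDeriv φ.symm (jetMap φ q)).1 = (totalDeriv φ q).1⁻¹ ∧
      jetMap φ.symm (jetMap φ q) = q := by
  have h1 : totalDeriv φ.symm (jetMap φ q) = (totalDeriv φ q).1⁻¹ • ((1 : ℝ), q.2.2) := by
    have h2 := totalDeriv_eq_smul hl
    have h3 : totalDeriv φ.symm (jetMap φ q) =
        fderiv ℝ φ.symm (φ (base q)) ((1 : ℝ), (jetMap φ q).2.2) := rfl
    have h4 : ((1 : ℝ), (jetMap φ q).2.2) = (totalDeriv φ q).1⁻¹ • totalDeriv φ q := by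
      rw [eq_inv_smul_iff₀ hl, ← h2]
    rw [h3, h4, map_smul]
    congr 1
    exact h.fderiv_symm_fderiv hq _
  have h5 : (totalDeriv φ.symm (jetMap φ q)).1 = (totalDeriv φ q).1⁻¹ := by simp [h1]
  refine ⟨h5, ?_⟩
  have h6 : φ.symm (base (jetMap φ q)) = base q := φ.left_inv hq
  ext1
  · exact (congrArg Prod.fst h6 :)
  ext1
  · exact (congrArg Prod.snd h6 :)
  · change (totalDeriv φ.symm (jetMap φ q)).1⁻¹ • (totalDeriv φ.symm (jetMap φ q)).2 = _
    rw [h5, h1]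
    simp [hl]

/-- The jet in the old coordinates that corresponds to a jet in the transformed domain. -/
lemma of_mem (h : IsDiffeo φ) {J : Set (Jet N)} {q : Jet N} (hq : q ∈ transformedDomain φ J) :
    jetMap φ.symm q ∈ J ∧ base (jetMap φ.symm q) ∈ φ.source ∧
      (totalDeriv φ (jetMap φ.symm q)).1 ≠ 0 ∧ jetMap φ (jetMap φ.symm q) = q := by
  obtain ⟨h1, h2, h3⟩ := hq
  have h4 := h.symm.jetMap_left_inv (q := q) h1 h2
  rw [φ.symm_symm] at h4
  exact ⟨h3, φ.map_target h1, by rw [h4.1]; exact inv_ne_zero h2, h4.2⟩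

lemma jetMap_mem (h : IsDiffeo φ) {J : Set (Jet N)} {q : Jet N} (hJ : q ∈ J)
    (hq : base q ∈ φ.source) (hl : (totalDeriv φ q).1 ≠ 0) :
    jetMap φ q ∈ transformedDomain φ J := by
  obtain ⟨h1, h2⟩ := h.jetMap_left_inv hq hl
  exact ⟨φ.map_source hq, by rw [h1]; exact inv_ne_zero hl, by rw [h2]; exact hJ⟩

lemma isOpen_transformedDomain (h : IsDiffeo φ) {J : Set (Jet N)} (hJ : IsOpen J) :
    IsOpen (transformedDomain φ J) := by
  rw [isOpen_iff_mem_nhds]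
  rintro q ⟨h1, h2, h3⟩
  have c1 := h.contDiffAt_symm h1
  have e1 : ∀ᶠ q' in 𝓝 q, base q' ∈ φ.target :=
    continuous_base.continuousAt.preimage_mem_nhds (φ.open_target.mem_nhds h1)
  have e2 : ∀ᶠ q' in 𝓝 q, (totalDeriv φ.symm q').1 ≠ 0 :=
    (contDiffAt_totalDeriv c1).fst.continuousAt.eventually_ne h2
  have e3 : ∀ᶠ q' in 𝓝 q, jetMap φ.symm q' ∈ J :=
    (contDiffAt_jetMap c1 h2).continuousAt.preimage_mem_nhds (hJ.mem_nhds h3)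
  filter_upwards [e1, e2, e3] with q' a b c using ⟨a, b, c⟩

lemma contDiffAt_odeField {w : Jet N → (Fin N → ℝ)} {q : Jet N} (hw : ContDiffAt ℝ ∞ w q) :
    ContDiffAt ℝ ∞ (odeField w) q :=
  contDiffAt_const.prodMk (contDiff_vel.contDiffAt.prodMk hw)

lemma contDiffAt_transformedRHS (h : IsDiffeo φ) {J : Set (Jet N)} (hJ : IsOpen J)
    {w : Jet N → (Fin N → ℝ)} (hw : ContDiffOn ℝ ∞ w J) {q : Jet N}
    (hq : q ∈ transformedDomain φ J) : ContDiffAt ℝ ∞ (transformedRHS φ w) q := by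
  obtain ⟨h1, h2, h3, h4⟩ := h.of_mem hq
  have cF := contDiffAt_jetMap (h.contDiffAt h2) h3
  have cT := contDiffAt_totalDeriv (h.contDiffAt h2)
  have cA := contDiffAt_odeField (hw.contDiffAt (hJ.mem_nhds h1))
  have cG := contDiffAt_jetMap (h.contDiffAt_symm hq.1) hq.2.1
  have cD : ContDiffAt ℝ ∞ (fderiv ℝ (fun q' => (jetMap φ q').2.2)) (jetMap φ.symm q) :=
    cF.snd.snd.fderiv_right (by simp)
  have c1 := (cT.fst.inv h3).smul (cD.clm_apply cA)
  exact c1.comp q cG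

lemma contDiffAt_transformedField (h : IsDiffeo φ) {X : Base N → Base N} {p : Base N}
    (hp : p ∈ φ.target) (hX : ContDiffAt ℝ ∞ X (φ.symm p)) :
    ContDiffAt ℝ ∞ (transformedField φ X) p := by
  have c1 : ContDiffAt ℝ ∞ (fderiv ℝ φ) (φ.symm p) :=
    (h.contDiffAt (φ.map_target hp)).fderiv_right (by simp)
  exact (c1.clm_apply hX).comp p (h.contDiffAt_symm hp)

lemma transformedField_apply {X : Base N → Base N} {p : Base N} (hp : p ∈ φ.source) :
    transformedField φ X (φ p) = fderiv ℝ φ p (X p) := by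
  simp [transformedField, φ.left_inv hp]

lemma lieBracket_transformedField (h : IsDiffeo φ) {X Y : Base N → Base N} {p : Base N}
    (hp : p ∈ φ.source) (hX : ContDiffAt ℝ ∞ X p) (hY : ContDiffAt ℝ ∞ Y p) :
    VectorField.lieBracket ℝ (transformedField φ X) (transformedField φ Y) (φ p) =
      fderiv ℝ φ p (VectorField.lieBracket ℝ X Y p) := by
  have hs : φ.symm (φ p) = p := φ.left_inv hp
  have cX := h.contDiffAt_transformedField (X := X) (φ.map_source hp) (by rwa [hs])
  have cY := h.contDiffAt_transformedField (X := Y) (φ.map_source hp) (by rwa [hs])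
  have hn := φ.open_source.mem_nhds hp
  exact fderiv_lieBracket_of_related (h.contDiffAt hp) (hX.differentiableAt (by simp))
    (hY.differentiableAt (by simp)) (cX.differentiableAt (by simp))
    (cY.differentiableAt (by simp))
    (by filter_upwards [hn] with y hy using transformedField_apply hy)
    (by filter_upwards [hn] with y hy using transformedField_apply hy)

lemma prolong_transformedField (h : IsDiffeo φ) {X : Base N → Base N} {q : Jet N}
    (hq : base q ∈ φ.source) (hl : (totalDeriv φ q).1 ≠ 0) (hX : ContDiffAt ℝ ∞ X (base q)) :
    prolong (transformedField φ X) (jetMap φ q) = fderiv ℝ (jetMap φ) q (prolong X q) := by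
  refine (fderiv_jetMap_prolong (h.contDiffAt hq) hl hX
    (h.contDiffAt_transformedField (φ.map_source hq) (by rwa [φ.left_inv hq])) ?_).symm
  filter_upwards [φ.open_source.mem_nhds hq] with y hy using transformedField_apply hy

lemma odeField_transformedRHS (h : IsDiffeo φ) {w : Jet N → (Fin N → ℝ)} {q : Jet N}
    (hq : base q ∈ φ.source) (hl : (totalDeriv φ q).1 ≠ 0) :
    (totalDeriv φ q).1 • odeField (transformedRHS φ w) (jetMap φ q) =
      fderiv ℝ (jetMap φ) q (odeField w q) := by
  refine (fderiv_jetMap_odeField (h.contDiffAt hq) hl ?_).symm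
  simp [transformedRHS, (h.jetMap_left_inv hq hl).2]

end IsDiffeo

/-- If the bracket with the operator of a system is a multiple of this operator, then the factor
is the one in the symmetry condition. -/
lemma lieBracket_odeField_of_eq_smul {N : ℕ} {V : Jet N → Jet N} {w : Jet N → (Fin N → ℝ)}
    {q : Jet N} {k : ℝ} (hV : DifferentiableAt ℝ V q) (hw : DifferentiableAt ℝ w q)
    (h : VectorField.lieBracket ℝ V (odeField w) q = k • odeField w q) :
    VectorField.lieBracket ℝ V (odeField w) q =
      -(fderiv ℝ (fun q' => (V q').1) q (odeField w q)) • odeField w q := by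
  -- The first component of the operator is the constant 1, so that of the bracket is `-A(ξ)`.
  have h1 : k = -(fderiv ℝ (fun q' => (V q').1) q (odeField w q)) := by
    have hA : HasFDerivAt (odeField w)
        ((0 : Jet N →L[ℝ] ℝ).prod ((velL N).prod (fderiv ℝ w q))) q :=
      (hasFDerivAt_const (1 : ℝ) q).prodMk ((velL N).hasFDerivAt.prodMk hw.hasFDerivAt)
    have h2 := congrArg Prod.fst h
    rw [hV.hasFDerivAt.fst.fderiv]
    simp only [VectorField.lieBracket, hA.fderiv] at h2
    simpa [odeField] using h2.symm
  rw [h, h1]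

/-- The symmetry condition is invariant under point transformations. -/
lemma IsDiffeo.isPointSymmetry {N : ℕ} {φ : OpenPartialHomeomorph (Base N) (Base N)}
    (h : IsDiffeo φ) {J : Set (Jet N)} (hJ : IsOpen J) {w : Jet N → (Fin N → ℝ)}
    (hw : ContDiffOn ℝ ∞ w J) {X : Base N → Base N} (hX : ContDiffOn ℝ ∞ X (base '' J))
    (hs : IsPointSymmetry J w X) :
    IsPointSymmetry (transformedDomain φ J) (transformedRHS φ w) (transformedField φ X) := by
  intro q' hq'
  have hU : IsOpen (base '' J) := isOpenMap_base J hJ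
  have hq'2 := h.of_mem hq'
  set q := jetMap φ.symm q' with hqdef
  obtain ⟨h1, h2, h3, h4⟩ := hq'2
  have cX : ContDiffAt ℝ ∞ X (base q) := hX.contDiffAt (hU.mem_nhds ⟨q, h1, rfl⟩)
  have cφ := h.contDiffAt h2
  have cF := contDiffAt_jetMap cφ h3
  have cA := IsDiffeo.contDiffAt_odeField (hw.contDiffAt (hJ.mem_nhds h1))
  have cV := contDiffAt_prolong cX
  have cw' := h.contDiffAt_transformedRHS hJ hw hq'
  have cX' : ContDiffAt ℝ ∞ (transformedField φ X) (base q') := by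
    refine h.contDiffAt_transformedField hq'.1 ?_
    exact cX
  have cV' := contDiffAt_prolong cX'
  have cT := (contDiffAt_totalDeriv cφ).fst
  have cinv : ContDiffAt ℝ ∞ (fun y => (totalDeriv φ y).1⁻¹) q := cT.inv h3
  have hnear : ∀ᶠ y in 𝓝 q, y ∈ J ∧ base y ∈ φ.source ∧ (totalDeriv φ y).1 ≠ 0 :=
    (hJ.eventually_mem h1).and (((φ.open_source.preimage continuous_base).eventually_mem h2).and
      (cT.continuousAt.eventually_ne h3))
  -- The old and new operators are related only after division by `dt/dx`. The Leibniz rule keeps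
  -- the bracket a multiple of the operator, and `lieBracket_odeField_of_eq_smul` identifies the
  -- factor without computing it.
  have key := fderiv_lieBracket_of_related (F := jetMap φ) (x := q) (V := prolong X)
    (W := fun y => (totalDeriv φ y).1⁻¹ • odeField w y)
    (V' := prolong (transformedField φ X)) (W' := odeField (transformedRHS φ w)) cF
    (cV.differentiableAt (by simp)) ((cinv.smul cA).differentiableAt (by simp))
    (by rw [h4]; exact cV'.differentiableAt (by simp))
    (by rw [h4]; exact (IsDiffeo.contDiffAt_odeField cw').differentiableAt (by simp))
    (by
      filter_upwards [hnear] with y hy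
      exact h.prolong_transformedField hy.2.1 hy.2.2
        (hX.contDiffAt (hU.mem_nhds ⟨y, hy.1, rfl⟩)))
    (by
      filter_upwards [hnear] with y hy
      rw [map_smul, ← h.odeField_transformedRHS hy.2.1 hy.2.2, inv_smul_smul₀ hy.2.2])
  rw [VectorField.lieBracket_smul_right (cinv.differentiableAt (by simp))
    (cA.differentiableAt (by simp)), hs q h1, smul_smul, ← add_smul, map_smul,
    ← h.odeField_transformedRHS h2 h3, smul_smul, h4] at key
  exact lieBracket_odeField_of_eq_smul (cV'.differentiableAt (by simp))
    (cw'.differentiableAt (by simp)) key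

/-! ### Reduction of vector fields on the jet space -/

/-- The restriction of a vector to the components in `S`, extended by zero. -/
noncomputable def restr {N : ℕ} (S : Set (Fin N)) : (Fin N → ℝ) →L[ℝ] (Fin N → ℝ) :=
  open scoped Classical in
  ContinuousLinearMap.pi fun μ => if μ ∈ S then ContinuousLinearMap.proj μ else 0

section restr

variable {N : ℕ} {S : Set (Fin N)}

lemma restr_apply_of_mem {μ : Fin N} (h : μ ∈ S) (v : Fin N → ℝ) : restr S v μ = v μ := by
  simp [restr, h]

lemma restr_apply_of_notMem {μ : Fin N} (h : μ ∉ S) (v : Fin N → ℝ) : restr S v μ = 0 := by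
  simp [restr, h]

lemma restr_restr (v : Fin N → ℝ) : restr S (restr S v) = restr S v := by
  ext μ
  by_cases h : μ ∈ S <;> simp [restr_apply_of_mem, restr_apply_of_notMem, h]

lemma restr_univ (v : Fin N → ℝ) : restr Set.univ v = v := by
  ext μ
  simp [restr_apply_of_mem]

lemma restr_single_of_notMem {μ : Fin N} (h : μ ∉ S) (a : ℝ) : restr S (Pi.single μ a) = 0 := by
  ext ν
  by_cases hν : ν ∈ S
  · have : ν ≠ μ := by rintro rfl; exact h hν
    simp [restr_apply_of_mem hν, this]
  · simp [restr_apply_of_notMem hν]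

lemma restr_single_of_mem {μ : Fin N} (h : μ ∈ S) (a : ℝ) :
    restr S (Pi.single μ a) = Pi.single μ a := by
  ext ν
  by_cases hν : ν ∈ S
  · simp [restr_apply_of_mem hν]
  · have : ν ≠ μ := by rintro rfl; exact hν h
    simp [restr_apply_of_notMem hν, this]

lemma restr_range {ι : Type*} [Fintype ι] (e : ι ↪ Fin N) (v : Fin N → ℝ) :
    restr (Set.range e) v = ∑ i, v (e i) • (Pi.single (e i) 1 : Fin N → ℝ) := by
  classical
  ext μ
  by_cases h : μ ∈ Set.range e
  · obtain ⟨i, rfl⟩ := h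
    rw [restr_apply_of_mem (Set.mem_range_self i)]
    simp [Pi.single_apply]
  · rw [restr_apply_of_notMem h]
    have : ∀ i, μ ≠ e i := fun i hi => h ⟨i, hi.symm⟩
    simp [this]

end restr

/-- The linear map that drops the `∂_{s^μ}`-components, `μ ∈ S`, of a vector on the jet space. -/
noncomputable def reduceL {N : ℕ} (S : Set (Fin N)) : Jet N →L[ℝ] Jet N :=
  ContinuousLinearMap.id ℝ (Jet N) -
    (0 : Jet N →L[ℝ] ℝ).prod (((restr S).comp ((ContinuousLinearMap.fst ℝ _ _).comp
      (ContinuousLinearMap.snd ℝ ℝ _))).prod 0)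

section reduction

variable {N : ℕ} {S : Set (Fin N)}

lemma reduceL_apply (q : Jet N) : reduceL S q = q - (0, restr S q.2.1, 0) := rfl

lemma reduceL_fst (q : Jet N) : (reduceL S q).1 = q.1 := by simp [reduceL_apply]

lemma reduceL_snd_snd (q : Jet N) : (reduceL S q).2.2 = q.2.2 := by simp [reduceL_apply]

lemma reduceL_apply_of_notMem {μ : Fin N} (h : μ ∉ S) (q : Jet N) :
    (reduceL S q).2.1 μ = q.2.1 μ := by simp [reduceL_apply, restr_apply_of_notMem h]

lemma reduceL_apply_of_mem {μ : Fin N} (h : μ ∈ S) (q : Jet N) :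
    (reduceL S q).2.1 μ = 0 := by simp [reduceL_apply, restr_apply_of_mem h]

lemma reduce_eq (V : Jet N → Jet N) : reduce S V = fun q => reduceL S (V q) := by
  funext q
  ext1
  · rw [reduceL_fst]; rfl
  ext1
  · ext μ
    by_cases h : μ ∈ S
    · rw [reduceL_apply_of_mem h]; simp [reduce, h]
    · rw [reduceL_apply_of_notMem h]; simp [reduce, h]
  · rw [reduceL_snd_snd]; rfl

/-- Reduction replaces `A` by `A - b`, where `b` is its part along `S`. Dropping the same part of
`V` leaves the derivative of `A` along `V` unchanged, by `hinv`. After the full symmetry condition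
is subtracted, only the terms with the derivative of `V` along `b` remain. -/
lemma reduced_symmetry_iff {V A : Jet N → Jet N} {q : Jet N} (hV : DifferentiableAt ℝ V q)
    (hA : DifferentiableAt ℝ A q)
    (hs : VectorField.lieBracket ℝ V A q = -(fderiv ℝ (fun q' => (V q').1) q (A q)) • A q)
    (hinv : ∀ u, fderiv ℝ A q (0, restr S u, 0) = 0) :
    VectorField.lieBracket ℝ (reduce S V) (reduce S A) q =
        -(fderiv ℝ (fun q' => (reduce S V q').1) q (reduce S A q)) • reduce S A q ↔
      reduceL S (fderiv ℝ V q (0, restr S (A q).2.1, 0) -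
        (fderiv ℝ V q (0, restr S (A q).2.1, 0)).1 • A q) = 0 := by
  have e1 : fderiv ℝ (reduce S V) q = (reduceL S).comp (fderiv ℝ V q) := by
    rw [reduce_eq]; exact ((reduceL S).hasFDerivAt.comp q hV.hasFDerivAt).fderiv
  have e2 : fderiv ℝ (reduce S A) q = (reduceL S).comp (fderiv ℝ A q) := by
    rw [reduce_eq]; exact ((reduceL S).hasFDerivAt.comp q hA.hasFDerivAt).fderiv
  have e3 : ∀ h, fderiv ℝ (fun q' => (reduce S V q').1) q h = (fderiv ℝ V q h).1 := by
    intro h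
    have : (fun q' => (reduce S V q').1) = fun q' => (V q').1 := rfl
    rw [this, hV.hasFDerivAt.fst.fderiv]; rfl
  have e4 : ∀ h, fderiv ℝ (fun q' => (V q').1) q h = (fderiv ℝ V q h).1 := by
    intro h
    rw [hV.hasFDerivAt.fst.fderiv]; rfl
  simp only [VectorField.lieBracket] at hs ⊢
  rw [e4] at hs
  rw [e1, e2, e3, reduce_eq, reduce_eq, ContinuousLinearMap.comp_apply,
    ContinuousLinearMap.comp_apply]
  set b : Jet N := (0, restr S (A q).2.1, 0) with hb
  have r1 : reduceL S (A q) = A q - b := rfl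
  have r2 : fderiv ℝ A q (reduceL S (V q)) = fderiv ℝ A q (V q) := by
    rw [reduceL_apply, map_sub, hinv, sub_zero]
  have hs' : fderiv ℝ A q (V q) =
      fderiv ℝ V q (A q) + -(fderiv ℝ V q (A q)).1 • A q := by
    rw [← hs]; abel
  rw [r2, hs', ← sub_eq_zero]
  have r3 : fderiv ℝ V q (reduceL S (A q)) = fderiv ℝ V q (A q) - fderiv ℝ V q b := by
    rw [r1, map_sub]
  rw [r3]
  simp only [map_sub, map_add, map_smul, Prod.fst_sub]
  refine Eq.congr_left ?_
  module

end reduction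

/-! ### Derivatives along the commuting directions -/

/-- The first prolongation commutes with derivatives along constant directions of the base. -/
lemma fderiv_prolong_vertical {N : ℕ} {X : Base N → Base N} {q : Jet N}
    (hX : ContDiffAt ℝ ∞ X (base q)) (u : Fin N → ℝ) :
    fderiv ℝ (prolong X) q (0, u, 0) = prolong (fun p => fderiv ℝ X p (0, u)) q := by
  have hdX := ((hX.differentiableAt (by simp)).hasFDerivAt).comp q (hasFDerivAt_base q)
  have hddX : DifferentiableAt ℝ (fderiv ℝ X) (base q) :=
    (hX.fderiv_right (m := ∞) (by simp)).differentiableAt (by simp)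
  have hT := ((contDiffAt_totalDeriv hX).differentiableAt (by simp)).hasFDerivAt
  have hsymm : IsSymmSndFDerivAt ℝ X (base q) := hX.isSymmSndFDerivAt minSmoothness_two_le_infty
  have h1 := hdX.fst.prodMk (hdX.snd.prodMk (hT.snd.sub (hT.fst.smul (velL N).hasFDerivAt)))
  have h2 : fderiv ℝ (prolong X) q = _ := h1.fderiv
  have h3 : totalDeriv (fun p => fderiv ℝ X p (0, u)) q =
      fderiv ℝ (totalDeriv X) q (0, u, 0) := by
    rw [fderiv_totalDeriv hX, totalDeriv]
    have h4 := (hddX.hasFDerivAt.clm_apply (hasFDerivAt_const ((0 : ℝ), u) (base q))).fderiv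
    rw [h4]
    have h5 : base ((0, u, 0) : Jet N) = (0, u) := rfl
    rw [h5, ← hsymm.eq]
    have h6 : ((0 : ℝ), (0 : Fin N → ℝ)) = 0 := rfl
    simp [h6]
  rw [h2, prolong, h3]
  have h5 : base ((0, u, 0) : Jet N) = (0, u) := rfl
  ext <;> simp [baseL_apply, velL_apply, h5]

section vertical

variable {N : ℕ} {S : Set (Fin N)}

/-- On `T`, the derivatives of `X` along the coordinate directions in `S` are constant combinations
of these directions. -/
structure IsVerticallyAffine (S : Set (Fin N)) (T : Set (Base N)) (X : Base N → Base N) :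
    Prop where
  fst_eq_zero : ∀ p ∈ T, ∀ u, (fderiv ℝ X p (0, restr S u)).1 = 0
  snd_eq_zero : ∀ p ∈ T, ∀ u, ∀ β ∉ S, (fderiv ℝ X p (0, restr S u)).2 β = 0
  fderiv_eq_zero : ∀ p ∈ T, ∀ u, fderiv ℝ (fun p => fderiv ℝ X p (0, restr S u)) p = 0

variable {T : Set (Base N)} {X : Base N → Base N} {w : Jet N → (Fin N → ℝ)}

/-- Sufficiency half of the criterion: the multiple of `A` drops out, base components outside `S`
vanish, and the velocity components are built from the vanishing derivative of `∂_b X`. -/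
lemma IsVerticallyAffine.reduceL_eq_zero (h : IsVerticallyAffine S T X) {q : Jet N}
    (hq : base q ∈ T) (u : Fin N → ℝ) :
    reduceL S (prolong (fun p => fderiv ℝ X p (0, restr S u)) q -
      (fderiv ℝ X (base q) (0, restr S u)).1 • odeField w q) = 0 := by
  rw [h.fst_eq_zero _ hq, zero_smul, sub_zero]
  have h1 := h.fderiv_eq_zero _ hq u
  ext1
  · rw [reduceL_fst]; exact h.fst_eq_zero _ hq u
  ext1
  · ext μ
    by_cases hμ : μ ∈ S
    · rw [reduceL_apply_of_mem hμ]; rfl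
    · rw [reduceL_apply_of_notMem hμ]; exact h.snd_eq_zero _ hq u μ hμ
  · rw [reduceL_snd_snd]
    simp [prolong, totalDeriv, h1]

/-- The conditions on the components of the reduced symmetry condition, on an open set of jets
over each point of `T`, force the vertical derivatives of `X` to be constant and vertical. -/
lemma isVerticallyAffine_of_reduceL {D : Set (Jet N)} (hD : IsOpen D) (hT : IsOpen T)
    (hDT : ∀ p ∈ T, ∃ v, ((p.1, p.2, v) : Jet N) ∈ D)
    (hX : ∀ p ∈ T, ContDiffAt ℝ ∞ X p)
    (hred : ∀ q ∈ D, reduceL S (prolong (fun p => fderiv ℝ X p (0, restr S q.2.2)) q -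
      (fderiv ℝ X (base q) (0, restr S q.2.2)).1 • odeField w q) = 0)
    (huniv : S = Set.univ → ∀ q ∈ D, (fderiv ℝ X (base q) (0, q.2.2)).1 = 0) :
    IsVerticallyAffine S T X := by
  have hO : ∀ p : Base N, IsOpen {v | ((p.1, p.2, v) : Jet N) ∈ D} := fun p =>
    hD.preimage (by fun_prop)
  have hlin : ∀ (p : Base N) (v u : Fin N → ℝ) (t : ℝ), fderiv ℝ X p (0, restr S (v + t • u)) =
      fderiv ℝ X p (0, restr S v) + t • fderiv ℝ X p (0, restr S u) := by
    intro p v u t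
    rw [← map_smul, ← map_add]
    simp
  have hvert : ∀ p ∈ T, ∀ u, (fderiv ℝ X p (0, restr S u)).1 = 0 ∧
      ∀ β ∉ S, (fderiv ℝ X p (0, restr S u)).2 β = 0 := by
    intro p hp
    obtain ⟨v₀, hv₀⟩ := hDT p hp
    -- If `S` is everything, no component outside `S` is left to control `ξ`, and only `huniv` does.
    by_cases hS : S = Set.univ
    · intro u
      refine ⟨?_, fun β hβ => absurd (hS ▸ Set.mem_univ β) hβ⟩
      refine eq_zero_of_quadratic_of_isOpen
        (f := fun u => (fderiv ℝ X p (0, restr S u)).1) ?_ (hO p) hv₀ ?_ u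
      · intro v u
        refine ⟨(fderiv ℝ X p (0, restr S v)).1, (fderiv ℝ X p (0, restr S u)).1, 0, fun t => ?_⟩
        rw [hlin]
        simp only [Prod.fst_add, Prod.smul_fst, smul_eq_mul]
        ring
      · intro v hv
        have := huniv hS _ hv
        simp only [hS, restr_univ]
        exact this
    · have hβ : ∀ β ∉ S, ∀ v, (fderiv ℝ X p (0, restr S v)).2 β -
          (fderiv ℝ X p (0, restr S v)).1 * v β = 0 := by
        intro β hβ
        refine eq_zero_of_quadratic_of_isOpen (f := fun v => (fderiv ℝ X p (0, restr S v)).2 β -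
          (fderiv ℝ X p (0, restr S v)).1 * v β) ?_ (hO p) hv₀ ?_
        · intro v u
          refine ⟨(fderiv ℝ X p (0, restr S v)).2 β - (fderiv ℝ X p (0, restr S v)).1 * v β,
            (fderiv ℝ X p (0, restr S u)).2 β - (fderiv ℝ X p (0, restr S u)).1 * v β
              - (fderiv ℝ X p (0, restr S v)).1 * u β,
            - (fderiv ℝ X p (0, restr S u)).1 * u β, fun t => ?_⟩
          rw [hlin]
          simp only [Prod.fst_add, Prod.snd_add, Prod.smul_fst, Prod.smul_snd, smul_eq_mul,
            Pi.add_apply, Pi.smul_apply]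
          ring
        · intro v hv
          have h1 := congrArg (fun q : Jet N => q.2.1 β) (hred _ hv)
          simp only [reduceL_apply_of_notMem hβ] at h1
          exact h1
      -- Two velocities with the same `S`-part and `β`-components 0 and 1 separate the two terms.
      -- They may lie outside `D`, hence the extension of the quadratic identity to all velocities.
      have hβ' : ∀ β ∉ S, ∀ u, (fderiv ℝ X p (0, restr S u)).1 = 0 ∧
          (fderiv ℝ X p (0, restr S u)).2 β = 0 := by
        intro β hb u
        have h1 := hβ β hb (restr S u)
        have h2 := hβ β hb (restr S u + Pi.single β 1)
        rw [map_add, restr_single_of_notMem hb, add_zero, restr_restr] at h2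
        rw [restr_restr, restr_apply_of_notMem hb] at h1
        simp only [Pi.add_apply, restr_apply_of_notMem hb, Pi.single_eq_same] at h2
        constructor <;> linarith
      obtain ⟨β, hb⟩ := (Set.ne_univ_iff_exists_notMem S).1 hS
      exact fun u => ⟨(hβ' β hb u).1, fun β hb => (hβ' β hb u).2⟩
  refine ⟨fun p hp u => (hvert p hp u).1, fun p hp u => (hvert p hp u).2, ?_⟩
  intro p hp
  obtain ⟨v₀, hv₀⟩ := hDT p hp
  have hddX : DifferentiableAt ℝ (fderiv ℝ X) p :=
    ((hX p hp).fderiv_right (m := ∞) (by simp)).differentiableAt (by simp)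
  have hsymm : IsSymmSndFDerivAt ℝ X p := (hX p hp).isSymmSndFDerivAt minSmoothness_two_le_infty
  set B := fderiv ℝ (fderiv ℝ X) p with hB
  have hW : ∀ u h, fderiv ℝ (fun p => fderiv ℝ X p (0, restr S u)) p h = B h (0, restr S u) := by
    intro u h
    have h4 := (hddX.hasFDerivAt.clm_apply (hasFDerivAt_const ((0 : ℝ), restr S u) p)).fderiv
    rw [h4]
    simp [hB]
  have hB1 : ∀ u h, (B h (0, restr S u)).1 = 0 := by
    intro u h
    rw [← hW]
    have hdW : DifferentiableAt ℝ (fun p => fderiv ℝ X p (0, restr S u)) p :=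
      hddX.clm_apply (differentiableAt_const _)
    have e1 := hdW.hasFDerivAt.fst.fderiv
    have e2 : (fun p => (fderiv ℝ X p (0, restr S u)).1) =ᶠ[𝓝 p] fun _ => 0 := by
      filter_upwards [hT.mem_nhds hp] with y hy using (hvert y hy u).1
    rw [e2.fderiv_eq] at e1
    have := DFunLike.congr_fun e1 h
    simpa using this.symm
  -- With `∂_b ξ = 0`, the velocity components of `hred` say that the total derivative of `∂_b X`
  -- vanishes. It is quadratic in `v`.
  have hq : ∀ v, B (1, v) (0, restr S v) = 0 := by
    intro v
    ext1
    · exact hB1 _ _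
    ext μ
    refine eq_zero_of_quadratic_of_isOpen (f := fun v => (B (1, v) (0, restr S v)).2 μ) ?_
      (hO p) hv₀ ?_ v
    · intro v u
      refine ⟨(B (1, v) (0, restr S v)).2 μ,
        (B (1, v) (0, restr S u)).2 μ + (B (0, u) (0, restr S v)).2 μ,
        (B (0, u) (0, restr S u)).2 μ, fun t => ?_⟩
      have e1 : ((1 : ℝ), v + t • u) = (1, v) + t • (0, u) := by ext <;> simp
      have e2 : ((0 : ℝ), restr S (v + t • u)) = (0, restr S v) + t • (0, restr S u) := by
        ext <;> simp
      rw [e1, e2]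
      simp only [map_add, map_smul, add_apply, smul_apply,
        Prod.snd_add, Prod.smul_snd, Pi.add_apply, Pi.smul_apply, smul_eq_mul]
      ring
    · intro v hv
      have h1 := congrArg (fun q : Jet N => q.2.2 μ) (hred _ hv)
      have h2 : (fderiv ℝ X (base ((p.1, p.2, v) : Jet N)) (0, restr S v)).1 = 0 :=
        (hvert p hp v).1
      simp only [reduceL_snd_snd] at h1
      rw [h2, zero_smul, sub_zero] at h1
      have h3 : totalDeriv (fun p => fderiv ℝ X p (0, restr S v)) ((p.1, p.2, v) : Jet N) =
        B (1, v) (0, restr S v) := hW v (1, v)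
      simp only [prolong, h3, hB1] at h1
      simpa using h1
  -- Comparing `v` with `-v` separates the linear part from the quadratic part, which is then
  -- polarised.
  have hsplit : ∀ v, B (1, 0) (0, restr S v) = 0 ∧ B (0, v) (0, restr S v) = 0 := by
    intro v
    have e1 : ((1 : ℝ), v) = (1, 0) + (0, v) := by simp
    have e2 : ((1 : ℝ), -v) = (1, 0) - (0, v) := by simp
    have e3 : ((0 : ℝ), restr S (-v)) = -(0, restr S v) := by simp
    have h1 := hq v
    have h2 := hq (-v)
    rw [e1, map_add, add_apply] at h1
    rw [e2, e3, map_sub, map_neg, sub_apply, neg_eq_zero, sub_eq_zero] at h2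
    rw [← h2, ← two_smul ℝ, smul_eq_zero] at h1
    have h3 := h1.resolve_left two_ne_zero
    exact ⟨h3, h2 ▸ h3⟩
  have hpol : ∀ x y, B (0, x) (0, restr S y) = - B (0, y) (0, restr S x) := by
    intro x y
    have h1 := (hsplit (x + y)).2
    have e1 : ((0 : ℝ), x + y) = (0, x) + (0, y) := by simp
    have e2 : ((0 : ℝ), restr S (x + y)) = (0, restr S x) + (0, restr S y) := by simp
    rw [e1, e2] at h1
    simp only [map_add, add_apply, (hsplit _).2, zero_add, add_zero] at h1
    rw [eq_neg_iff_add_eq_zero, add_comm]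
    exact h1
  -- On directions in `S` the form is antisymmetric by polarisation and symmetric as a second
  -- derivative.
  have hSS : ∀ x y, B (0, restr S x) (0, restr S y) = 0 := by
    intro x y
    have h1 := hpol (restr S x) (restr S y)
    rw [restr_restr, restr_restr, hsymm.eq (0, restr S y)] at h1
    exact self_eq_neg.1 h1
  intro u
  refine ContinuousLinearMap.ext fun h => ?_
  rw [hW]
  have e1 : h = h.1 • (1, 0) + (0, h.2) := by ext <;> simp
  have h2 : B (0, h.2) (0, restr S u) = 0 := by
    have := hpol h.2 (restr S u)
    rw [restr_restr, hSS, neg_zero] at this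
    exact this
  rw [e1, map_add, map_smul, add_apply, smul_apply, (hsplit u).1, h2]
  simp

end vertical

/-! ### Linearity of prolongation, and transformed jets -/

lemma prolong_congr {N : ℕ} {X Y : Base N → Base N} {q : Jet N} (h : X =ᶠ[𝓝 (base q)] Y) :
    prolong X q = prolong Y q := by
  have h1 : totalDeriv X q = totalDeriv Y q := by simp [totalDeriv, h.fderiv_eq]
  simp [prolong, h1, h.self_of_nhds]

lemma prolong_sum {N : ℕ} {ι : Type*} (s : Finset ι) (a : ι → ℝ) {Z : ι → Base N → Base N}
    {q : Jet N} (hZ : ∀ i, DifferentiableAt ℝ (Z i) (base q)) :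
    prolong (fun p => ∑ i ∈ s, a i • Z i p) q = ∑ i ∈ s, a i • prolong (Z i) q := by
  have h1 : totalDeriv (fun p => ∑ i ∈ s, a i • Z i p) q = ∑ i ∈ s, a i • totalDeriv (Z i) q := by
    rw [totalDeriv, fderiv_fun_sum (A := fun i p => a i • Z i p)
      fun i _ => (hZ i).const_smul (a i)]
    simp only [fderiv_fun_const_smul (hZ _)]
    simp [totalDeriv]
  ext μ
  · simp [prolong, Prod.fst_sum]
  · simp [prolong, Prod.fst_sum, Prod.snd_sum]
  · simp only [prolong, h1, Prod.fst_sum, Prod.snd_sum, Prod.smul_fst, Prod.smul_snd]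
    simp [Finset.sum_mul, ← Finset.sum_sub_distrib, mul_sub, mul_assoc]

lemma prolong_const {N : ℕ} (u : Base N) (q : Jet N) :
    prolong (fun _ => u) q = (u.1, u.2, 0) := by
  ext <;> simp [prolong, totalDeriv]

lemma fderiv_jetMap_injective {N : ℕ} {φ : OpenPartialHomeomorph (Base N) (Base N)}
    (h : IsDiffeo φ) {q : Jet N} (hq : base q ∈ φ.source) (hl : (totalDeriv φ q).1 ≠ 0) :
    Function.Injective (fderiv ℝ (jetMap φ) q) := by
  have hinv := h.jetMap_left_inv hq hl
  have c1 := contDiffAt_jetMap (h.contDiffAt hq) hl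
  have c2 : ContDiffAt ℝ ∞ (jetMap φ.symm) (jetMap φ q) :=
    contDiffAt_jetMap (h.contDiffAt_symm (φ.map_source hq))
      (by rw [hinv.1]; exact inv_ne_zero hl)
  have h1 := (c2.differentiableAt (by simp)).hasFDerivAt.comp q
    (c1.differentiableAt (by simp)).hasFDerivAt
  have h2 : (jetMap φ.symm ∘ jetMap φ) =ᶠ[𝓝 q] id := by
    filter_upwards [(φ.open_source.preimage continuous_base).mem_nhds hq,
      (contDiffAt_totalDeriv (h.contDiffAt hq)).fst.continuousAt.eventually_ne hl] with y hy hy'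
    exact (h.jetMap_left_inv hy hy').2
  have h3 := h1.fderiv.symm.trans (h2.fderiv_eq.trans fderiv_id)
  exact Function.LeftInverse.injective (g := fderiv ℝ (jetMap φ.symm) (jetMap φ q))
    fun v => DFunLike.congr_fun h3 v

/-- There are transformed jets over each point of the target. -/
lemma exists_mem_transformedDomain {N : ℕ} {φ : OpenPartialHomeomorph (Base N) (Base N)}
    (h : IsDiffeo φ) {J : Set (Jet N)} (hJ : IsOpen J) (hs : φ.source ⊆ base '' J) {p : Base N}
    (hp : p ∈ φ.target) : ∃ v, ((p.1, p.2, v) : Jet N) ∈ transformedDomain φ J := by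
  have hp0 := φ.map_target hp
  set p₀ := φ.symm p with hp₀
  obtain ⟨q₀, hq₀, hq₀b⟩ := hs hp0
  have hO : IsOpen {v | ((p₀.1, p₀.2, v) : Jet N) ∈ J} := hJ.preimage (by fun_prop)
  have hv₀ : q₀.2.2 ∈ {v | ((p₀.1, p₀.2, v) : Jet N) ∈ J} := by
    rw [← hq₀b]; exact hq₀
  obtain ⟨v, hv, hl⟩ : ∃ v, ((p₀.1, p₀.2, v) : Jet N) ∈ J ∧ (fderiv ℝ φ p₀ (1, v)).1 ≠ 0 := by
    -- Otherwise `dt/dx`, affine in the velocity, vanishes for all velocities, so `dt = 0` at a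
    -- point where the derivative of `φ` is invertible.
    by_contra! hcon
    have hz := eq_zero_of_quadratic_of_isOpen (f := fun v => (fderiv ℝ φ p₀ (1, v)).1)
      (fun v u => ⟨(fderiv ℝ φ p₀ (1, v)).1, (fderiv ℝ φ p₀ (0, u)).1, 0, fun t => by
        have e : ((1 : ℝ), v + t • u) = (1, v) + t • (0, u) := by ext <;> simp
        rw [e, map_add, map_smul]
        simp
        ring⟩) hO hv₀ hcon
    have hz' : ∀ k, (fderiv ℝ φ p₀ k).1 = 0 := by
      intro k
      have e : k = (1, k.2) + (k.1 - 1) • (1, 0) := by ext <;> simp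
      have h1 := hz k.2
      have h2 := hz 0
      rw [e, map_add, map_smul]
      simp [h1, h2]
    have := h.fderiv_fderiv_symm hp (1, 0)
    have h3 := hz' (fderiv ℝ φ.symm p (1, 0))
    rw [this] at h3
    simp at h3
  have hm := h.jetMap_mem (q := (p₀.1, p₀.2, v)) hv hp0 hl
  refine ⟨(jetMap φ (p₀.1, p₀.2, v)).2.2, ?_⟩
  have hb : φ p₀ = p := φ.right_inv hp
  have e : ((p.1, p.2, (jetMap φ (p₀.1, p₀.2, v)).2.2) : Jet N) = jetMap φ (p₀.1, p₀.2, v) := by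
    rw [← hb]; rfl
  rw [e]
  exact hm

/-! ### Symmetries in normal form -/

namespace IsNormalForm

variable {N r : ℕ} {J : Set (Jet N)} {w : Jet N → (Fin N → ℝ)} {Z : Fin r → Base N → Base N}
  {I : Finset (Fin r)} {φ : OpenPartialHomeomorph (Base N) (Base N)} {e : I ↪ Fin N}
  {X : Base N → Base N}

lemma isDiffeo {U : Set (Base N)} (h : IsNormalForm U Z I φ e) : IsDiffeo φ :=
  ⟨h.contDiffOn, h.contDiffOn_symm⟩

lemma eventually_eq {U : Set (Base N)} (h : IsNormalForm U Z I φ e) {p : Base N}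
    (hp : p ∈ φ.target) (i : I) :
    transformedField φ (Z i) =ᶠ[𝓝 p] fun _ => (0, Pi.single (e i) 1) := by
  filter_upwards [φ.open_target.mem_nhds hp] with y hy using h.normal i y hy

lemma prolong_eq {U : Set (Base N)} (h : IsNormalForm U Z I φ e) {q : Jet N}
    (hq : base q ∈ φ.target) (i : I) :
    prolong (transformedField φ (Z i)) q = (0, Pi.single (e i) 1, 0) := by
  rw [prolong_congr (h.eventually_eq hq i), prolong_const]

lemma fderiv_apply {U : Set (Base N)} (h : IsNormalForm U Z I φ e) {p : Base N}
    (hp : p ∈ φ.source) (i : I) : fderiv ℝ φ p (Z i p) = (0, Pi.single (e i) 1) := by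
  rw [← IsDiffeo.transformedField_apply hp, h.normal i _ (φ.map_source hp)]

/-- In the new coordinates `Z_i` is a constant field, so bracketing with it is a partial derivative.
-/
lemma fderiv_lieBracket {U : Set (Base N)} (h : IsNormalForm U Z I φ e) {p : Base N}
    (hp : p ∈ φ.source) {i : I} (hZ : ContDiffAt ℝ ∞ (Z i) p) (hX : ContDiffAt ℝ ∞ X p) :
    fderiv ℝ φ p (VectorField.lieBracket ℝ (Z i) X p) =
      fderiv ℝ (transformedField φ X) (φ p) (0, Pi.single (e i) 1) := by
  rw [← h.isDiffeo.lieBracket_transformedField hp hZ hX, VectorField.lieBracket,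
    (h.eventually_eq (φ.map_source hp) i).fderiv_eq, h.normal i _ (φ.map_source hp)]
  simp

lemma card_of_range_eq_univ (he : Set.range e = Set.univ) : I.card = N := by
  have h1 : Function.Bijective e := ⟨e.injective, Set.range_eq_univ.1 he⟩
  have h2 := Fintype.card_of_bijective h1
  simpa using h2

/-- The transformed system does not depend on the coordinates along the commuting fields. -/
lemma fderiv_odeField_vertical (h : IsNormalForm (base '' J) Z I φ e) (hJ : IsOpen J)
    (hw : ContDiffOn ℝ ∞ w J) (hZ : ∀ M, ContDiffOn ℝ ∞ (Z M) (base '' J))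
    (hsymm : ∀ M, IsPointSymmetry J w (Z M)) {q : Jet N} (hq : q ∈ transformedDomain φ J)
    (u : Fin N → ℝ) :
    fderiv ℝ (odeField (transformedRHS φ w)) q (0, restr (Set.range e) u, 0) = 0 := by
  have h1 : ∀ i : I, fderiv ℝ (odeField (transformedRHS φ w)) q (0, Pi.single (e i) 1, 0) = 0 := by
    intro i
    have hs := h.isDiffeo.isPointSymmetry hJ hw (hZ i) (hsymm i) q hq
    have he : prolong (transformedField φ (Z i)) =ᶠ[𝓝 q] fun _ => (0, Pi.single (e i) 1, 0) := by
      filter_upwards [(φ.open_target.preimage continuous_base).mem_nhds hq.1] with y hy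
        using h.prolong_eq hy i
    have he' : (fun q' => (prolong (transformedField φ (Z i)) q').1) =ᶠ[𝓝 q] fun _ => 0 := by
      filter_upwards [he] with y hy
      rw [hy]
    rw [VectorField.lieBracket, he.fderiv_eq, he'.fderiv_eq, he.self_of_nhds] at hs
    simpa using hs
  have h2 : ((0, restr (Set.range e) u, 0) : Jet N) =
      ∑ i, u (e i) • ((0, Pi.single (e i) 1, 0) : Jet N) := by
    rw [restr_range]
    ext <;> simp [Prod.fst_sum, Prod.snd_sum]
  rw [h2, map_sum]
  simp only [map_smul, h1, smul_zero, Finset.sum_const_zero]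

/-- The velocity in the direction of differentiation is frozen at `q`, so `∂_b X` is a field on the
base and has a prolongation of its own. -/
lemma symmetryCondition_reduce_iff (h : IsNormalForm (base '' J) Z I φ e) (hJ : IsOpen J)
    (hw : ContDiffOn ℝ ∞ w J) (hZ : ∀ M, ContDiffOn ℝ ∞ (Z M) (base '' J))
    (hsymm : ∀ M, IsPointSymmetry J w (Z M)) (hX : ContDiffOn ℝ ∞ X (base '' J))
    (hXs : IsPointSymmetry J w X) :
    SymmetryCondition (transformedDomain φ J)
        (reduce (Set.range e) (prolong (transformedField φ X)))
        (reduce (Set.range e) (odeField (transformedRHS φ w))) ↔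
      ∀ q ∈ transformedDomain φ J, reduceL (Set.range e)
        (prolong (fun p => fderiv ℝ (transformedField φ X) p (0, restr (Set.range e) q.2.2)) q -
          (fderiv ℝ (transformedField φ X) (base q) (0, restr (Set.range e) q.2.2)).1 •
            odeField (transformedRHS φ w) q) = 0 := by
  refine forall₂_congr fun q hq => ?_
  have hd := h.isDiffeo
  have hU : IsOpen (base '' J) := isOpenMap_base J hJ
  have cX : ContDiffAt ℝ ∞ (transformedField φ X) (base q) :=
    hd.contDiffAt_transformedField hq.1
      (hX.contDiffAt (hU.mem_nhds (h.source_subset (φ.map_target hq.1))))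
  have cV := contDiffAt_prolong cX
  have cA := IsDiffeo.contDiffAt_odeField (hd.contDiffAt_transformedRHS hJ hw hq)
  rw [reduced_symmetry_iff (cV.differentiableAt (by simp)) (cA.differentiableAt (by simp))
    (hd.isPointSymmetry hJ hw hX hXs q hq) (h.fderiv_odeField_vertical hJ hw hZ hsymm hq)]
  have h1 : (odeField (transformedRHS φ w) q).2.1 = q.2.2 := rfl
  rw [h1, fderiv_prolong_vertical cX]
  rfl

/-- A field whose brackets with the commuting fields are constant combinations of them is
vertically affine in normal form. -/
lemma isVerticallyAffine_of_lieBracket (h : IsNormalForm (base '' J) Z I φ e) (hJ : IsOpen J)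
    (hZ : ∀ M, ContDiffOn ℝ ∞ (Z M) (base '' J)) (hX : ContDiffOn ℝ ∞ X (base '' J))
    (c : I → I → ℝ)
    (hbr : ∀ i : I, ∀ p ∈ base '' J, VectorField.lieBracket ℝ (Z i) X p = ∑ j, c i j • Z j p) :
    IsVerticallyAffine (Set.range e) φ.target (transformedField φ X) := by
  have hU : IsOpen (base '' J) := isOpenMap_base J hJ
  have key : ∀ u, ∀ p ∈ φ.target, fderiv ℝ (transformedField φ X) p (0, restr (Set.range e) u) =
      ((0 : ℝ), ∑ i, u (e i) • ∑ j, c i j • (Pi.single (e j) 1 : Fin N → ℝ)) := by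
    intro u p hp
    have h1 : ∀ i, fderiv ℝ (transformedField φ X) p (0, Pi.single (e i) 1) =
        ((0 : ℝ), ∑ j, c i j • (Pi.single (e j) 1 : Fin N → ℝ)) := by
      intro i
      have hp0 := φ.map_target hp
      have hn := hU.mem_nhds (h.source_subset hp0)
      have h2 := h.fderiv_lieBracket hp0 (i := i) ((hZ i).contDiffAt hn) (hX.contDiffAt hn)
      rw [φ.right_inv hp] at h2
      rw [← h2, hbr i _ (h.source_subset hp0), map_sum]
      simp only [map_smul, h.fderiv_apply hp0]
      ext <;> simp [Prod.fst_sum, Prod.snd_sum]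
    have h3 : ((0 : ℝ), restr (Set.range e) u) =
        ∑ i, u (e i) • ((0 : ℝ), (Pi.single (e i) 1 : Fin N → ℝ)) := by
      rw [restr_range]
      ext <;> simp [Prod.fst_sum, Prod.snd_sum]
    rw [h3, map_sum]
    simp only [map_smul, h1]
    ext <;> simp [Prod.fst_sum, Prod.snd_sum]
  refine ⟨fun p hp u => by rw [key u p hp], fun p hp u β hβ => ?_, fun p hp u => ?_⟩
  · rw [key u p hp]
    have : ∀ j, β ≠ e j := fun j hj => hβ ⟨j, hj.symm⟩
    simp [this]
  · have h1 : (fun p => fderiv ℝ (transformedField φ X) p (0, restr (Set.range e) u)) =ᶠ[𝓝 p]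
        fun _ => ((0 : ℝ), ∑ i, u (e i) • ∑ j, c i j • (Pi.single (e j) 1 : Fin N → ℝ)) := by
      filter_upwards [φ.open_target.mem_nhds hp] with y hy using key u y hy
    rw [h1.fderiv_eq]
    simp

/-- In normal form, the brackets of the commuting fields with a vertically affine field are locally
constant combinations of the commuting fields. -/
lemma lieBracket_of_isVerticallyAffine (h : IsNormalForm (base '' J) Z I φ e) (hJ : IsOpen J)
    (hZ : ∀ M, ContDiffOn ℝ ∞ (Z M) (base '' J)) (hX : ContDiffOn ℝ ∞ X (base '' J))
    (hv : IsVerticallyAffine (Set.range e) φ.target (transformedField φ X)) {p₀ : Base N}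
    (hp₀ : p₀ ∈ φ.source) :
    ∃ c : I → I → ℝ, ∀ᶠ p in 𝓝 p₀, ∀ i : I,
      VectorField.lieBracket ℝ (Z i) X p = ∑ j, c i j • Z j p := by
  have hU : IsOpen (base '' J) := isOpenMap_base J hJ
  -- A vanishing derivative gives constancy only on connected sets, hence the ball.
  obtain ⟨ε, hε, hb⟩ := Metric.isOpen_iff.1 φ.open_target _ (φ.map_source hp₀)
  set W : I → Base N → Base N := fun i p =>
    fderiv ℝ (transformedField φ X) p (0, Pi.single (e i) 1) with hW
  have hWr : ∀ i p, W i p =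
      fderiv ℝ (transformedField φ X) p (0, restr (Set.range e) (Pi.single (e i) 1)) := by
    intro i p
    rw [restr_single_of_mem (Set.mem_range_self i)]
  have hconst : ∀ i, ∀ p ∈ Metric.ball (φ p₀) ε, W i p = W i (φ p₀) := by
    intro i p hp
    refine Metric.isOpen_ball.is_const_of_fderiv_eq_zero (convex_ball _ _).isPreconnected
      (f := W i) (𝕜 := ℝ) ?_ ?_ hp (Metric.mem_ball_self hε)
    · intro y hy
      have cX : ContDiffAt ℝ ∞ (transformedField φ X) y :=
        h.isDiffeo.contDiffAt_transformedField (hb hy)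
          (hX.contDiffAt (hU.mem_nhds (h.source_subset (φ.map_target (hb hy)))))
      have : ContDiffAt ℝ ∞ (W i) y :=
        (cX.fderiv_right (m := ∞) (by simp)).clm_apply contDiffAt_const
      exact (this.differentiableAt (by simp)).differentiableWithinAt
    · intro y hy
      have := hv.fderiv_eq_zero y (hb hy) (Pi.single (e i) 1)
      simp only [← hWr] at this
      exact this
  refine ⟨fun i j => (W i (φ p₀)).2 (e j), ?_⟩
  filter_upwards [φ.open_source.mem_nhds hp₀,
    (φ.continuousAt hp₀).preimage_mem_nhds (Metric.ball_mem_nhds _ hε)] with p hp hpb i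
  have hn := hU.mem_nhds (h.source_subset hp)
  refine Function.LeftInverse.injective (h.isDiffeo.fderiv_symm_fderiv hp) ?_
  rw [h.fderiv_lieBracket hp ((hZ i).contDiffAt hn) (hX.contDiffAt hn), map_sum]
  simp only [map_smul, h.fderiv_apply hp]
  change W i (φ p) = _
  rw [hconst i _ hpb]
  have h1 : (W i (φ p₀)).1 = 0 := by
    rw [hWr]; exact hv.fst_eq_zero _ (φ.map_source hp₀) _
  have h2 : (W i (φ p₀)).2 = restr (Set.range e) (W i (φ p₀)).2 := by
    ext β
    by_cases hβ : β ∈ Set.range e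
    · rw [restr_apply_of_mem hβ]
    · rw [restr_apply_of_notMem hβ, hWr]
      exact hv.snd_eq_zero _ (φ.map_source hp₀) _ β hβ
  ext1
  · simp [h1, Prod.fst_sum]
  · refine (h2.trans (restr_range e _)).trans ?_
    simp [Prod.snd_sum]

/-- If all dependent variables are used up by the normal form, and the operator of the system is
generically independent of the prolonged generators, then the reduced symmetry condition forces the
total vertical derivative of the first component to vanish. -/
lemma fst_eq_zero_of_dense (h : IsNormalForm (base '' J) Z I φ e) (hJ : IsOpen J)
    (hZ : ∀ M, ContDiffOn ℝ ∞ (Z M) (base '' J))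
    (hX : ContDiffOn ℝ ∞ X (base '' J)) (he : Set.range e = Set.univ) (c : I → Fin r → ℝ)
    (hbr : ∀ i : I, ∀ p ∈ base '' J, VectorField.lieBracket ℝ (Z i) X p = ∑ L, c i L • Z L p)
    (hA : J ⊆ closure {q ∈ J |
      odeField w q ∉ Submodule.span ℝ (Set.range fun M => prolong (Z M) q)})
    (hred : ∀ q ∈ transformedDomain φ J, reduceL (Set.range e)
        (prolong (fun p => fderiv ℝ (transformedField φ X) p (0, restr (Set.range e) q.2.2)) q -
          (fderiv ℝ (transformedField φ X) (base q) (0, restr (Set.range e) q.2.2)).1 •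
            odeField (transformedRHS φ w) q) = 0)
    {q : Jet N} (hq : q ∈ transformedDomain φ J) :
    (fderiv ℝ (transformedField φ X) (base q) (0, q.2.2)).1 = 0 := by
  have hU : IsOpen (base '' J) := isOpenMap_base J hJ
  have hd := h.isDiffeo
  by_contra hne
  obtain ⟨h1, h2, h3, h4⟩ := hd.of_mem hq
  set q₀ := jetMap φ.symm q with hq₀
  have cF := contDiffAt_jetMap (hd.contDiffAt h2) h3
  have cX : ContDiffAt ℝ ∞ (transformedField φ X) (base q) :=
    hd.contDiffAt_transformedField hq.1
      (hX.contDiffAt (hU.mem_nhds (h.source_subset (φ.map_target hq.1))))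
  have hcont : ContinuousAt
      (fun q : Jet N => (fderiv ℝ (transformedField φ X) (base q) (0, q.2.2)).1) q := by
    have c1 : ContDiffAt ℝ ∞ (fun q : Jet N => fderiv ℝ (transformedField φ X) (base q)) q :=
      (cX.fderiv_right (m := ∞) (by simp)).comp q contDiff_base.contDiffAt
    exact (c1.clm_apply
      (contDiffAt_const.prodMk contDiff_vel.contDiffAt)).fst.continuousAt
  have hev : ∀ᶠ y in 𝓝 q₀, base y ∈ φ.source ∧ (totalDeriv φ y).1 ≠ 0 ∧
      (fderiv ℝ (transformedField φ X) (base (jetMap φ y)) (0, (jetMap φ y).2.2)).1 ≠ 0 := by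
    refine ((φ.open_source.preimage continuous_base).eventually_mem h2).and
      (((contDiffAt_totalDeriv (hd.contDiffAt h2)).fst.continuousAt.eventually_ne h3).and ?_)
    have : Filter.Tendsto (jetMap φ) (𝓝 q₀) (𝓝 q) := by
      have := cF.continuousAt.tendsto
      rwa [h4] at this
    exact this.eventually (hcont.eventually_ne hne)
  -- The nonzero value persists near the jet, so density provides a jet where it is nonzero and `A`
  -- is independent of the prolonged generators.
  obtain ⟨y, ⟨hy1, hy2, hy3⟩, hyJ, hyA⟩ := mem_closure_iff_nhds.1 (hA h1) _ hev
  apply hyA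
  have hyD := hd.jetMap_mem hyJ hy1 hy2
  set x := jetMap φ y with hx
  have hxb : base x ∈ φ.target := hyD.1
  set S : Submodule ℝ (Jet N) :=
    Submodule.span ℝ (Set.range fun M => prolong (transformedField φ (Z M)) x) with hS
  have hmem : ∀ M, prolong (transformedField φ (Z M)) x ∈ S := fun M =>
    Submodule.subset_span ⟨M, rfl⟩
  have hW : (fun p => fderiv ℝ (transformedField φ X) p (0, restr (Set.range e) x.2.2))
      =ᶠ[𝓝 (base x)] fun p =>
        ∑ L, (∑ i, x.2.2 (e i) * c i L) • transformedField φ (Z L) p := by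
    filter_upwards [φ.open_target.mem_nhds hxb] with p hp
    have hp0 := φ.map_target hp
    have hn := hU.mem_nhds (h.source_subset hp0)
    have h5 : ∀ i, fderiv ℝ (transformedField φ X) p (0, Pi.single (e i) 1) =
        ∑ L, c i L • transformedField φ (Z L) p := by
      intro i
      have h2 := h.fderiv_lieBracket hp0 (i := i) ((hZ i).contDiffAt hn) (hX.contDiffAt hn)
      rw [φ.right_inv hp] at h2
      rw [← h2, hbr i _ (h.source_subset hp0), map_sum]
      simp only [map_smul]
      rfl
    have h6 : ((0 : ℝ), restr (Set.range e) x.2.2) =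
        ∑ i, x.2.2 (e i) • ((0 : ℝ), (Pi.single (e i) 1 : Fin N → ℝ)) := by
      rw [restr_range]
      ext <;> simp [Prod.fst_sum, Prod.snd_sum]
    rw [h6, map_sum]
    simp only [map_smul, h5, Finset.smul_sum, Finset.sum_smul, smul_smul]
    exact Finset.sum_comm
  have hdZ : ∀ M, DifferentiableAt ℝ (transformedField φ (Z M)) (base x) := fun M =>
    (hd.contDiffAt_transformedField hxb ((hZ M).contDiffAt
      (hU.mem_nhds (h.source_subset (φ.map_target hxb))))).differentiableAt (by simp)
  have hr := hred x hyD
  rw [prolong_congr hW, prolong_sum _ _ hdZ, reduceL_apply, sub_eq_zero] at hr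
  set f := (fderiv ℝ (transformedField φ X) (base x) (0, restr (Set.range e) x.2.2)).1 with hf
  have hf0 : f ≠ 0 := by
    rw [hf, he, restr_univ]; exact hy3
  have hvert : ∀ a, ((0, restr (Set.range e) a, 0) : Jet N) ∈ S := by
    intro a
    have : ((0, restr (Set.range e) a, 0) : Jet N) =
        ∑ i, a (e i) • prolong (transformedField φ (Z i)) x := by
      rw [restr_range]
      simp only [h.prolong_eq hxb]
      ext <;> simp [Prod.fst_sum, Prod.snd_sum]
    rw [this]
    exact Submodule.sum_mem _ fun i _ => Submodule.smul_mem _ _ (hmem i)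
  -- By `hW` the prolongation of `∂_b X` lies in `S`. The reduction forgets only vertical vectors,
  -- which lie in `S` as combinations of the prolonged `Z_i`.
  have hfA : f • odeField (transformedRHS φ w) x ∈ S := by
    have h7 := sub_eq_iff_eq_add.1 hr
    have h8 := eq_sub_of_add_eq' h7.symm
    rw [h8]
    exact Submodule.sub_mem _
      (Submodule.sum_mem _ fun i _ => Submodule.smul_mem _ _ (hmem i)) (hvert _)
  have hA' : fderiv ℝ (jetMap φ) y (odeField w y) ∈ S := by
    rw [← hd.odeField_transformedRHS hy1 hy2]
    refine Submodule.smul_mem _ _ ?_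
    have := Submodule.smul_mem _ f⁻¹ hfA
    rwa [inv_smul_smul₀ hf0] at this
  have hSmap : S = (Submodule.span ℝ (Set.range fun M => prolong (Z M) y)).map
      (fderiv ℝ (jetMap φ) y : Jet N →ₗ[ℝ] Jet N) := by
    rw [Submodule.map_span, ← Set.range_comp, hS]
    congr 2
    funext M
    exact hd.prolong_transformedField hy1 hy2 ((hZ M).contDiffAt (hU.mem_nhds ⟨y, hyJ, rfl⟩))
  rw [hSmap] at hA'
  obtain ⟨z, hz, hz'⟩ := hA'
  have := fderiv_jetMap_injective hd hy1 hy2 hz'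
  rwa [← this]

/-- A symmetry that satisfies the reduced symmetry condition is vertically affine in normal form. -/
lemma isVerticallyAffine_of_reduce (h : IsNormalForm (base '' J) Z I φ e) (hJ : IsOpen J)
    (hw : ContDiffOn ℝ ∞ w J) (hZ : ∀ M, ContDiffOn ℝ ∞ (Z M) (base '' J))
    (hsymm : ∀ M, IsPointSymmetry J w (Z M)) (hX : ContDiffOn ℝ ∞ X (base '' J))
    (hXs : IsPointSymmetry J w X) (c : I → Fin r → ℝ)
    (hbr : ∀ i : I, ∀ p ∈ base '' J, VectorField.lieBracket ℝ (Z i) X p = ∑ L, c i L • Z L p)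
    (hA : I.card = N → J ⊆ closure {q ∈ J |
      odeField w q ∉ Submodule.span ℝ (Set.range fun M => prolong (Z M) q)})
    (hred : SymmetryCondition (transformedDomain φ J)
        (reduce (Set.range e) (prolong (transformedField φ X)))
        (reduce (Set.range e) (odeField (transformedRHS φ w)))) :
    IsVerticallyAffine (Set.range e) φ.target (transformedField φ X) := by
  have hU : IsOpen (base '' J) := isOpenMap_base J hJ
  rw [h.symmetryCondition_reduce_iff hJ hw hZ hsymm hX hXs] at hred
  exact isVerticallyAffine_of_reduceL (h.isDiffeo.isOpen_transformedDomain hJ) φ.open_target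
    (fun p hp => exists_mem_transformedDomain h.isDiffeo hJ h.source_subset hp)
    (fun p hp => h.isDiffeo.contDiffAt_transformedField hp
      (hX.contDiffAt (hU.mem_nhds (h.source_subset (φ.map_target hp)))))
    hred (fun he q hq => h.fst_eq_zero_of_dense hJ hZ hX he c hbr
      (hA (card_of_range_eq_univ he)) hred hq)

end IsNormalForm

/-! ### Constant combinations of generators -/

lemma lieBracket_sum_left {E ι : Type*} [NormedAddCommGroup E] [NormedSpace ℝ E] (s : Finset ι)
    (a : ι → ℝ) {Z : ι → E → E} {W : E → E} {p : E} (hZ : ∀ i ∈ s, DifferentiableAt ℝ (Z i) p) :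
    VectorField.lieBracket ℝ (fun p => ∑ i ∈ s, a i • Z i p) W p =
      ∑ i ∈ s, a i • VectorField.lieBracket ℝ (Z i) W p := by
  rw [VectorField.lieBracket, fderiv_fun_sum (A := fun i p => a i • Z i p)
    fun i hi => (hZ i hi).const_smul (a i), map_sum, sum_apply, ← Finset.sum_sub_distrib]
  refine Finset.sum_congr rfl fun i hi => ?_
  rw [fderiv_fun_const_smul (hZ i hi), VectorField.lieBracket, map_smul, smul_apply, smul_sub]

lemma lieBracket_sum_right {E ι : Type*} [NormedAddCommGroup E] [NormedSpace ℝ E] (s : Finset ι)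
    (a : ι → ℝ) {Z : ι → E → E} {W : E → E} {p : E} (hZ : ∀ i ∈ s, DifferentiableAt ℝ (Z i) p) :
    VectorField.lieBracket ℝ W (fun p => ∑ i ∈ s, a i • Z i p) p =
      ∑ i ∈ s, a i • VectorField.lieBracket ℝ W (Z i) p := by
  rw [VectorField.lieBracket_swap, lieBracket_sum_left s a hZ, ← Finset.sum_neg_distrib]
  refine Finset.sum_congr rfl fun i _ => ?_
  rw [VectorField.lieBracket_swap, smul_neg, neg_neg]

/-- Both sides of the symmetry condition are linear in the field. This makes `[Z_l, Z_k]`, as a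
combination of generators, a symmetry without prolonging a bracket. -/
lemma isPointSymmetry_sum {N r : ℕ} {J : Set (Jet N)} {w : Jet N → (Fin N → ℝ)} (hJ : IsOpen J)
    {Z : Fin r → Base N → Base N} (hZ : ∀ M, ContDiffOn ℝ ∞ (Z M) (base '' J))
    (hsymm : ∀ M, IsPointSymmetry J w (Z M)) (c : Fin r → ℝ) :
    IsPointSymmetry J w (fun p => ∑ M, c M • Z M p) := by
  intro q hq
  have hU : IsOpen (base '' J) := isOpenMap_base J hJ
  have cZ : ∀ M, ∀ y ∈ J, ContDiffAt ℝ ∞ (Z M) (base y) := fun M y hy =>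
    (hZ M).contDiffAt (hU.mem_nhds ⟨y, hy, rfl⟩)
  have dP : ∀ M, DifferentiableAt ℝ (prolong (Z M)) q := fun M =>
    (contDiffAt_prolong (cZ M q hq)).differentiableAt (by simp)
  have h1 : prolong (fun p => ∑ M, c M • Z M p) =ᶠ[𝓝 q] fun y => ∑ M, c M • prolong (Z M) y := by
    filter_upwards [hJ.mem_nhds hq] with y hy
    exact prolong_sum _ _ fun M => (cZ M y hy).differentiableAt (by simp)
  have h2 : (fun q' => (prolong (fun p => ∑ M, c M • Z M p) q').1) =
      fun q' => ∑ M, c M • (prolong (Z M) q').1 := by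
    funext q'
    simp [prolong, Prod.fst_sum]
  have h3 : VectorField.lieBracket ℝ (prolong fun p => ∑ M, c M • Z M p) (odeField w) q =
      VectorField.lieBracket ℝ (fun y => ∑ M, c M • prolong (Z M) y) (odeField w) q := by
    rw [VectorField.lieBracket, VectorField.lieBracket, h1.fderiv_eq, h1.self_of_nhds]
  have dP1 : ∀ M, DifferentiableAt ℝ (fun q' => (prolong (Z M) q').1) q := fun M => (dP M).fst
  rw [h3, lieBracket_sum_left _ _ fun M _ => dP M, h2,
    fderiv_fun_sum (A := fun M q' => c M • (prolong (Z M) q').1)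
      fun M _ => (dP1 M).const_smul (c M), sum_apply, ← Finset.sum_neg_distrib, Finset.sum_smul]
  refine Finset.sum_congr rfl fun M _ => ?_
  rw [hsymm M q hq, fderiv_fun_const_smul (dP1 M), smul_smul]
  simp

/-- Locally constant combinations of pointwise independent fields on a connected set are constant
combinations. -/
lemma exists_const_combination {E ι : Type*} [NormedAddCommGroup E] [NormedSpace ℝ E] [Fintype ι]
    {U : Set E} (hU : IsPreconnected U) {Z : ι → E → E}
    (hind : ∀ p ∈ U, LinearIndependent ℝ fun i => Z i p) {V : E → E}
    (hV : ∀ p₀ ∈ U, ∃ c : ι → ℝ, ∀ᶠ p in 𝓝 p₀, V p = ∑ i, c i • Z i p) :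
    ∃ c : ι → ℝ, ∀ p ∈ U, V p = ∑ i, c i • Z i p := by
  choose! c hc using hV
  rcases U.eq_empty_or_nonempty with rfl | ⟨p₀, hp₀⟩
  · exact ⟨0, by simp⟩
  have : PreconnectedSpace U := Subtype.preconnectedSpace hU
  -- Near `p` the coefficients chosen at `p` and those chosen at `y` both represent `V y`, so
  -- pointwise independence makes them equal.
  have hlc : IsLocallyConstant fun p : U => c p := by
    rw [IsLocallyConstant.iff_eventually_eq]
    intro p
    filter_upwards [continuous_subtype_val.continuousAt.eventually (hc p p.2)] with y hy
    have h1 := (hc y y.2).self_of_nhds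
    rw [h1] at hy
    have h2 : ∑ i, (c y i - c p i) • Z i y = 0 := by
      simp only [sub_smul, Finset.sum_sub_distrib, hy, sub_self]
    funext i
    exact sub_eq_zero.1 (Fintype.linearIndependent_iff.1 (hind y y.2) _ h2 i)
  refine ⟨c p₀, fun p hp => ?_⟩
  have := hlc.apply_eq_of_preconnectedSpace ⟨p, hp⟩ ⟨p₀, hp₀⟩
  rw [← this]
  exact (hc p hp).self_of_nhds

/-! ### Inheritance and structure constants -/

section

variable {N r : ℕ} {J : Set (Jet N)} {w : Jet N → (Fin N → ℝ)} {Z : Fin r → Base N → Base N}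
  {I : Finset (Fin r)}

/-- The bracket of a commuting generator with an inherited one only involves commuting
generators. -/
lemma structureConstant_eq_zero_of_isInherited
    (hJ : IsOpen J) (hconn : IsPreconnected (base '' J)) (hw : ContDiffOn ℝ ∞ w J)
    (hZ : ∀ M, ContDiffOn ℝ ∞ (Z M) (base '' J)) (hsymm : ∀ M, IsPointSymmetry J w (Z M))
    (hind : ∀ c : Fin r → ℝ, (∀ p ∈ base '' J, ∑ M, c M • Z M p = 0) → c = 0)
    {C : Fin r → Fin r → Fin r → ℝ}
    (halg : ∀ M K, ∀ p ∈ base '' J,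
      VectorField.lieBracket ℝ (Z M) (Z K) p = ∑ L, C M K L • Z L p)
    (htrans : ∀ p ∈ base '' J, LinearIndependent ℝ (fun i : I => Z i p))
    (hA : I.card = N → J ⊆ closure {q ∈ J |
      odeField w q ∉ Submodule.span ℝ (Set.range fun M => prolong (Z M) q)})
    {l : Fin r} (hl : IsInherited J w Z I (Z l)) {i : Fin r} (hi : i ∈ I) {L : Fin r}
    (hL : L ∉ I) : C i l L = 0 := by
  have hloc : ∀ p₀ ∈ base '' J, ∃ c : I → ℝ, ∀ᶠ p in 𝓝 p₀,
      VectorField.lieBracket ℝ (Z i) (Z l) p = ∑ j : I, c j • Z j p := by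
    intro p₀ hp₀
    obtain ⟨φ, e, hp, hn, hs⟩ := hl p₀ hp₀
    have hv := hn.isVerticallyAffine_of_reduce hJ hw hZ hsymm (hZ l) (hsymm l)
      (fun i L => C i l L) (fun i p hp => halg i l p hp) hA hs
    obtain ⟨c, hc⟩ := hn.lieBracket_of_isVerticallyAffine hJ hZ (hZ l) hv hp
    exact ⟨c ⟨i, hi⟩, hc.mono fun p hp => hp ⟨i, hi⟩⟩
  obtain ⟨c, hc⟩ := exists_const_combination hconn htrans hloc
  let d : Fin r → ℝ := fun L => if h : L ∈ I then c ⟨L, h⟩ else 0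
  have hd : ∀ p, ∑ j : I, c j • Z j p = ∑ L, d L • Z L p := by
    intro p
    have h1 : ∀ j : I, c j • Z j p = d j • Z j p := fun j => by simp [d]
    rw [Finset.sum_congr rfl fun j _ => h1 j, Finset.sum_coe_sort I fun L => d L • Z L p]
    refine Finset.sum_subset (Finset.subset_univ I) fun L _ hL => ?_
    simp [d, hL]
  -- Two constant expansions of one bracket agree, by independence over ℝ; `d` vanishes outside `I`.
  have h0 := hind (fun L => C i l L - d L) fun p hp => by
    simp only [sub_smul, Finset.sum_sub_distrib]
    rw [← halg i l p hp, hc p hp, hd, sub_self]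
  have := congrFun h0 L
  simpa [d, hL] using this

/-- A linear combination of generators whose brackets with the commuting generators are constant
combinations of these is inherited, provided that there are normal forms. -/
lemma isInherited_of_lieBracket (hJ : IsOpen J) (hw : ContDiffOn ℝ ∞ w J)
    (hZ : ∀ M, ContDiffOn ℝ ∞ (Z M) (base '' J)) (hsymm : ∀ M, IsPointSymmetry J w (Z M))
    (hnf : ∀ p ∈ base '' J, ∃ (φ : OpenPartialHomeomorph (Base N) (Base N)) (e : I ↪ Fin N),
      p ∈ φ.source ∧ IsNormalForm (base '' J) Z I φ e)
    {X : Base N → Base N} (hX : ContDiffOn ℝ ∞ X (base '' J)) (hXs : IsPointSymmetry J w X)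
    (c : I → I → ℝ)
    (hbr : ∀ i : I, ∀ p ∈ base '' J, VectorField.lieBracket ℝ (Z i) X p = ∑ j, c i j • Z j p) :
    IsInherited J w Z I X := by
  intro p hp
  obtain ⟨φ, e, hps, hn⟩ := hnf p hp
  refine ⟨φ, e, hps, hn, ?_⟩
  rw [hn.symmetryCondition_reduce_iff hJ hw hZ hsymm hX hXs]
  intro q hq
  exact (hn.isVerticallyAffine_of_lieBracket hJ hZ hX c hbr).reduceL_eq_zero hq.1 _

end

/-! ### The subalgebra -/

theorem corollary1 {N r : ℕ}
    -- the system `y'' = w(x, y, y')` on an open set `J` of jets, over a connected `(x, y)`-domain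
    (J : Set (Jet N)) (hJ : IsOpen J) (hconn : IsPreconnected (base '' J))
    (w : Jet N → (Fin N → ℝ)) (hw : ContDiffOn ℝ ∞ w J)
    -- linearly independent generators of Lie point symmetries, forming a Lie algebra
    (Z : Fin r → Base N → Base N) (hZ : ∀ M, ContDiffOn ℝ ∞ (Z M) (base '' J))
    (hsymm : ∀ M, IsPointSymmetry J w (Z M))
    (hind : ∀ c : Fin r → ℝ, (∀ p ∈ base '' J, ∑ M, c M • Z M p = 0) → c = 0)
    (C : Fin r → Fin r → Fin r → ℝ)
    (halg : ∀ M K, ∀ p ∈ base '' J,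
      VectorField.lieBracket ℝ (Z M) (Z K) p = ∑ L, C M K L • Z L p)
    -- the Abelian subalgebra, acting transitively in a subspace of its own dimension
    (I : Finset (Fin r))
    (habel : ∀ i ∈ I, ∀ j ∈ I, ∀ p ∈ base '' J, VectorField.lieBracket ℝ (Z i) (Z j) p = 0)
    (htrans : ∀ p ∈ base '' J, LinearIndependent ℝ (fun i : I => Z i p))
    -- `A` is independent of the generators (functions as coefficients, generic jets); this is
    -- required only if all dependent variables are used up by the normal form
    (hA : I.card = N → J ⊆ closure {q ∈ J |
      odeField w q ∉ Submodule.span ℝ (Set.range fun M => prolong (Z M) q)})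
    -- the inherited generators; the remaining ones contribute nothing to what is inherited
    (H : Finset (Fin r)) (hIH : Disjoint I H)
    (hinh : ∀ l ∈ H, IsInherited J w Z I (Z l))
    (hrest : ∀ c : Fin r → ℝ, IsInherited J w Z I (fun p => ∑ M, c M • Z M p) →
      ∀ M, M ∉ I → M ∉ H → c M = 0) :
    (∀ i ∈ I, ∀ j ∈ I, ∀ p ∈ base '' J, VectorField.lieBracket ℝ (Z i) (Z j) p = 0) ∧
    (∀ i ∈ I, ∀ l ∈ H, ∀ p ∈ base '' J,
      VectorField.lieBracket ℝ (Z i) (Z l) p = ∑ j ∈ I, C i l j • Z j p) ∧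
    (∀ l ∈ H, ∀ k ∈ H, ∀ p ∈ base '' J,
      VectorField.lieBracket ℝ (Z l) (Z k) p =
        ∑ j ∈ I, C l k j • Z j p + ∑ n ∈ H, C l k n • Z n p) ∧
    (∀ V ∈ Submodule.span ℝ (Z '' (I ∪ H)), ∀ W ∈ Submodule.span ℝ (Z '' (I ∪ H)),
      ∃ X ∈ Submodule.span ℝ (Z '' (I ∪ H)), ∀ p ∈ base '' J,
        VectorField.lieBracket ℝ V W p = X p) := by
  have hU : IsOpen (base '' J) := isOpenMap_base J hJ
  have cZ : ∀ M, ∀ p ∈ base '' J, ContDiffAt ℝ ∞ (Z M) p := fun M p hp =>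
    (hZ M).contDiffAt (hU.mem_nhds hp)
  have dZ : ∀ M, ∀ p ∈ base '' J, DifferentiableAt ℝ (Z M) p := fun M p hp =>
    (cZ M p hp).differentiableAt (by simp)
  have hCIH : ∀ i ∈ I, ∀ l ∈ H, ∀ L, L ∉ I → C i l L = 0 := fun i hi l hl L hL =>
    structureConstant_eq_zero_of_isInherited hJ hconn hw hZ hsymm hind halg htrans hA
      (hinh l hl) hi hL
  have hbIH : ∀ i ∈ I, ∀ l ∈ H, ∀ p ∈ base '' J,
      VectorField.lieBracket ℝ (Z i) (Z l) p = ∑ j ∈ I, C i l j • Z j p := by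
    intro i hi l hl p hp
    rw [halg i l p hp]
    refine (Finset.sum_subset (Finset.subset_univ I) fun L _ hL => ?_).symm
    rw [hCIH i hi l hl L hL, zero_smul]
  have hCHH : ∀ l ∈ H, ∀ k ∈ H, ∀ M, M ∉ I → M ∉ H → C l k M = 0 := by
    intro l hl k hk
    refine hrest (C l k) ?_
    have hXeq : ∀ p ∈ base '' J, (fun p => ∑ M, C l k M • Z M p) =ᶠ[𝓝 p]
        VectorField.lieBracket ℝ (Z l) (Z k) := by
      intro p hp
      filter_upwards [hU.mem_nhds hp] with y hy using (halg l k y hy).symm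
    refine isInherited_of_lieBracket hJ hw hZ hsymm (fun p hp => ?_)
      (ContDiffOn.sum fun M _ => (hZ M).const_smul (C l k M)) (isPointSymmetry_sum hJ hZ hsymm _)
      -- These coefficients come from `[Z_i, [Z_l, Z_k]] = [[Z_i, Z_l], Z_k] + [Z_l, [Z_i, Z_k]]`,
      -- with `hbIH` applied twice to each term.
      (fun i j => ∑ n ∈ I, (C i l n * C n k j - C i k n * C n l j)) ?_
    -- Normal forms are borrowed from the inheritance of `Z l`.
    · obtain ⟨φ, e, h1, h2, -⟩ := hinh l hl p hp
      exact ⟨φ, e, h1, h2⟩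
    · rintro ⟨i, hi⟩ p hp
      have hbr : ∀ m ∈ H, VectorField.lieBracket ℝ (Z i) (Z m) =ᶠ[𝓝 p]
          fun y => ∑ j ∈ I, C i m j • Z j y := by
        intro m hm
        filter_upwards [hU.mem_nhds hp] with y hy using hbIH i hi m hm y hy
      have e1 : VectorField.lieBracket ℝ (Z i) (fun p => ∑ M, C l k M • Z M p) p =
          VectorField.lieBracket ℝ (Z i) (VectorField.lieBracket ℝ (Z l) (Z k)) p :=
        Filter.EventuallyEq.rfl.lieBracket_vectorField_eq (hXeq p hp)
      have e2 : VectorField.lieBracket ℝ (VectorField.lieBracket ℝ (Z i) (Z l)) (Z k) p =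
          VectorField.lieBracket ℝ (fun y => ∑ j ∈ I, C i l j • Z j y) (Z k) p :=
        (hbr l hl).lieBracket_vectorField_eq Filter.EventuallyEq.rfl
      have e3 : VectorField.lieBracket ℝ (Z l) (VectorField.lieBracket ℝ (Z i) (Z k)) p =
          VectorField.lieBracket ℝ (Z l) (fun y => ∑ j ∈ I, C i k j • Z j y) p :=
        Filter.EventuallyEq.rfl.lieBracket_vectorField_eq (hbr k hk)
      have e4 := VectorField.leibniz_identity_lieBracket (𝕜 := ℝ) (n := ∞)
        minSmoothness_two_le_infty (cZ i p hp) (cZ l p hp) (cZ k p hp)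
      rw [e1, e4, e2, e3, lieBracket_sum_left _ _ fun M _ => dZ M p hp,
        lieBracket_sum_right _ _ fun M _ => dZ M p hp, ← Finset.sum_add_distrib]
      have e5 : ∀ n ∈ I, C i l n • VectorField.lieBracket ℝ (Z n) (Z k) p +
          C i k n • VectorField.lieBracket ℝ (Z l) (Z n) p =
          ∑ j ∈ I, (C i l n * C n k j - C i k n * C n l j) • Z j p := by
        intro n hn
        rw [VectorField.lieBracket_swap (V := Z l), hbIH n hn k hk p hp, hbIH n hn l hl p hp,
          smul_neg, ← sub_eq_add_neg, Finset.smul_sum, Finset.smul_sum, ← Finset.sum_sub_distrib]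
        simp only [sub_smul, smul_smul]
      rw [Finset.sum_congr rfl e5, Finset.sum_comm, Finset.sum_coe_sort I fun j =>
        (∑ n ∈ I, (C i l n * C n k j - C i k n * C n l j)) • Z j p]
      simp only [Finset.sum_smul]
  have hswap : ∀ L K, ∀ M, C L K M = - C K L M := by
    intro L K M
    have h0 := hind (fun M => C L K M + C K L M) fun p hp => by
      simp only [add_smul, Finset.sum_add_distrib]
      rw [← halg L K p hp, ← halg K L p hp, VectorField.lieBracket_swap, neg_add_cancel]
    exact eq_neg_of_add_eq_zero_left (congrFun h0 M)
  have hC : ∀ L ∈ I ∪ H, ∀ K ∈ I ∪ H, ∀ M, M ∉ I ∪ H → C L K M = 0 := by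
    intro L hL K hK M hM
    rw [Finset.mem_union, not_or] at hM
    rcases Finset.mem_union.1 hL with hL | hL <;> rcases Finset.mem_union.1 hK with hK | hK
    · exact congrFun (hind (C L K) fun p hp => by
        rw [← halg L K p hp]; exact habel L hL K hK p hp) M
    · exact hCIH L hL K hK M hM.1
    · rw [hswap, hCIH K hK L hL M hM.1, neg_zero]
    · exact hCHH L hL K hK M hM.1 hM.2
  have hbr : ∀ L ∈ I ∪ H, ∀ K ∈ I ∪ H, ∀ p ∈ base '' J,
      VectorField.lieBracket ℝ (Z L) (Z K) p = ∑ M ∈ I ∪ H, C L K M • Z M p := by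
    intro L hL K hK p hp
    rw [halg L K p hp]
    refine (Finset.sum_subset (Finset.subset_univ _) fun M _ hM => ?_).symm
    rw [hC L hL K hK M hM, zero_smul]
  refine ⟨habel, hbIH, fun l hl k hk p hp => ?_, fun V hV W hW => ?_⟩
  · rw [hbr l (Finset.mem_union_right _ hl) k (Finset.mem_union_right _ hk) p hp,
      Finset.sum_union hIH]
  · rw [← Finset.coe_union] at hV hW ⊢
    obtain ⟨a, rfl⟩ := (Submodule.mem_span_image_finset_iff_exists_fun ℝ).1 hV
    obtain ⟨b, rfl⟩ := (Submodule.mem_span_image_finset_iff_exists_fun ℝ).1 hW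
    refine ⟨∑ L, a L • ∑ K, b K • ∑ M ∈ I ∪ H, C L K M • Z M, ?_, ?_⟩
    · refine Submodule.sum_mem _ fun L _ => Submodule.smul_mem _ _ <|
        Submodule.sum_mem _ fun K _ => Submodule.smul_mem _ _ <|
        Submodule.sum_mem _ fun M hM => Submodule.smul_mem _ _ <|
        Submodule.subset_span ⟨M, hM, rfl⟩
    · intro p hp
      let Y : (I ∪ H : Finset (Fin r)) → Base N → Base N := fun L => Z L
      have hfun : ∀ a : (I ∪ H : Finset (Fin r)) → ℝ,
          (∑ L, a L • Z L) = fun p => ∑ L, a L • Z L p := fun a => by ext1 p; simp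
      rw [hfun, hfun, lieBracket_sum_left _ _ (Z := Y) fun M _ => dZ M p hp]
      simp only [Finset.sum_apply, Pi.smul_apply]
      refine Finset.sum_congr rfl fun L _ => ?_
      rw [lieBracket_sum_right _ _ (Z := Y) fun M _ => dZ M p hp]
      congr 1
      refine Finset.sum_congr rfl fun K _ => ?_
      rw [hbr L L.2 K K.2 p hp]
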